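/- Notation. Let $d\ge 1$ and let $\Omega\subset\mathbb R^d$ be compact and convex. A field $f\in L^2(\mathbb R^d)$ (complex-valued) is bandlimited to $\Omega$ if its Fourier transform $F(\omega)=\int f(r)e^{-\mathsf i\langle\omega,r\rangle}\,dr$ vanishes (almost everywhere) outside $\Omega$; such an $f$ is identified with its continuous representative. A set $\Lambda\subset\mathbb R^d$ is uniformly discrete if the distances between its distinct points are bounded below by a positive constant. A countable collection $P$ of $\kappa$-dimensional manifolds in $\mathbb R^d$ is a Nyquist $\kappa$-manifold set for $\Omega$ if there is a uniformly discrete set $\Lambda$ of points on the manifolds of $P$ such that every field bandlimited to $\Omega$ is uniquely determined, among the fields bandlimited to $\Omega$, by its values on $\Lambda$. The manifold density of $P$ is $$\mu_\kappa(P)=\limsup_{a\to\infty}\frac{\sup_{x\in\mathbb R^d}\mathcal V^P_\kappa(a,x)}{\mathrm{Vol}(B^d_a)},$$ where $\mathcal V^P_\kappa(a,x)$ is the total $\kappa$-dimensional volume of the portions of the manifolds of $P$ in the closed ball of radius $a$ around $x$, and $B^d_a$ is the ball of radius $a$. A uniform hyperplane set is a collection $\{w+j\Delta h+H: j\in\mathbb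 Z\}$ with $w,h\in\mathbb R^d$, $\|h\|=1$, $\Delta>0$ and $H=\{r:\langle r,h\rangle=0\}$. Let $\mathcal E_\Omega$ be the collection of all Nyquist $(d-1)$-manifold sets for $\Omega$ that are finite unions of uniform hyperplane sets. For $u\ne 0$ let $B^u(\Omega)$ be the distance between the two supporting hyperplanes of $\Omega$ orthogonal to $u$ (for $\Omega\neq\emptyset$), and let $\mathcal W(\Omega)=\min_{u\neq0}B^u(\Omega)$ be the width of $\Omega$. Theorem. Let $\Omega\subset\mathbb R^d$, $d\ge1$, be nonempty, compact and convex. Then the minimum defining $\mathcal W(\Omega)$ is attained, and $$\inf_{Q\in\mathcal E_\Omega}\mu_{d-1}(Q)=\frac{\mathcal W(\Omega)}{2\pi}.$$ If moreover $\mathcal W(\Omega)>0$ and $\hat u\neq0$ is any direction with $B^{\hat u}(\Omega)=\mathcal W(\Omega)$, let $P^\epsilon=\{p^\epsilon_j:j\in\mathbb Z\}$ with $$p^\epsilon_j=j\left(\frac{2\pi}{\mathcal W(\Omega)}-\epsilon\right)\frac{\hat u}{\|\hat u\|}+\{r\in\mathbb R^d:\langle r,\hat u\rangle=0\}.$$ Then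 $P^\epsilon\in\mathcal E_\Omega$ for all $\epsilon\in\bigl(0,\tfrac{2\pi}{\mathcal W(\Omega)}\bigr)$, and $$\lim_{\epsilon\to0^+}\mu_{d-1}(P^\epsilon)=\inf_{Q\in\mathcal E_\Omega}\mu_{d-1}(Q)=\frac{\mathcal W(\Omega)}{2\pi}.$$ -/

import Mathlib

open MeasureTheory Filter Topology
open scoped ENNReal FourierTransform

namespace HyperplaneSampling

/-- The Euclidean space `ℝ^d`. -/
abbrev E (d : ℕ) : Type := EuclideanSpace ℝ (Fin d)

noncomputable section

/-! ### Bandlimited fields and sampling sets -/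

/-- The Fourier transform of a square-integrable field in angular frequency,
`F(ω) = ∫ f(r) exp(-i⟨ω, r⟩) dr`, extended to `L²` by Plancherel's theorem. Mathlib's `𝓕` has the
kernel `exp(-2πi⟨ξ, r⟩)`, hence the rescaling `ξ = ω / (2π)`. -/
def angularFourier {d : ℕ} (f : Lp ℂ 2 (volume : Measure (E d))) (ω : E d) : ℂ :=
  (𝓕 f : Lp ℂ 2 (volume : Measure (E d))) ((2 * Real.pi)⁻¹ • ω)

/-- The fields bandlimited to `Ω`: square-integrable fields whose Fourier transform vanishes
(almost everywhere, being an `L²` function) outside `Ω`. Point values are those of the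
continuous representative. -/
def bandlimited {d : ℕ} (Ω : Set (E d)) : Set (E d → ℂ) :=
  {f | Continuous f ∧ ∃ hf : MemLp f 2 (volume : Measure (E d)),
    ∀ᵐ ω : E d, ω ∉ Ω → angularFourier (hf.toLp f) ω = 0}

/-- Distinct points of `Λ` are at distance bounded below by a positive constant. -/
def UniformlyDiscrete {d : ℕ} (Λ : Set (E d)) : Prop :=
  ∃ r : ℝ, 0 < r ∧ ∀ x ∈ Λ, ∀ y ∈ Λ, x ≠ y → r < dist x y

/-- The uniformly discrete sets `Λ` such that every field bandlimited to `Ω` is uniquely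
determined by its values on `Λ`. -/
def samplingSets {d : ℕ} (Ω : Set (E d)) : Set (Set (E d)) :=
  {Λ | UniformlyDiscrete Λ ∧
    ∀ f ∈ bandlimited Ω, ∀ g ∈ bandlimited Ω, (∀ x ∈ Λ, f x = g x) → f = g}

/-! ### Manifold sets, their density, and the Nyquist condition -/

/-- `M ⊆ ℝ^d` with the subspace topology is a `κ`-manifold: every point of `M` has a
neighborhood in `M` that is homeomorphic to `ℝ^κ`. -/
def IsManifoldIn {d : ℕ} (κ : ℕ) (M : Set (E d)) : Prop :=
  ∀ x : M, ∃ U ∈ 𝓝 x, Nonempty (U ≃ₜ E κ)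

/-- A countable collection of `κ`-manifolds in `ℝ^d`. -/
def IsManifoldSet {d : ℕ} (κ : ℕ) (P : Set (Set (E d))) : Prop :=
  P.Countable ∧ ∀ p ∈ P, IsManifoldIn κ p

/-- The total `κ`-dimensional volume of the portions of the manifolds of `P` in the closed ball of
radius `a` around `x`. Here `μHE[κ]` is the `κ`-dimensional Hausdorff measure, normalized so as to
agree with Lebesgue measure on `ℝ^κ`. -/
def volumeInBall {d : ℕ} (κ : ℕ) (P : Set (Set (E d))) (a : ℝ) (x : E d) : ℝ≥0∞ :=
  ∑' p : P, (μHE[κ] : Measure (E d)) ((p : Set (E d)) ∩ Metric.closedBall x a)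

/-- The manifold density of a collection of `κ`-manifolds in `ℝ^d`. -/
def manifoldDensity {d : ℕ} (κ : ℕ) (P : Set (Set (E d))) : ℝ≥0∞ :=
  limsup (fun a : ℝ => (⨆ x : E d, volumeInBall κ P a x) / volume (Metric.closedBall (0 : E d) a))
    atTop

/-- The Nyquist `κ`-manifold sets for `Ω`: the manifold sets that contain the points of a sampling
set for `Ω`. -/
def nyquistManifoldSets {d : ℕ} (κ : ℕ) (Ω : Set (E d)) : Set (Set (Set (E d))) :=
  {P | IsManifoldSet κ P ∧ ∃ Λ ∈ samplingSets Ω, Λ ⊆ ⋃₀ P}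

/-! ### Uniform hyperplane sets -/

/-- The hyperplane through the origin that is orthogonal to `h`. -/
def hyperplane {d : ℕ} (h : E d) : Set (E d) := {r | inner ℝ r h = 0}

/-- The collection of the parallel hyperplanes `w + jΔh + H`, `j ∈ ℤ`, where `H` is the hyperplane
orthogonal to `h`. -/
def uniformHyperplaneSet {d : ℕ} (w h : E d) (Δ : ℝ) : Set (Set (E d)) :=
  Set.range fun j : ℤ => (fun r : E d => w + ((j : ℝ) * Δ) • h + r) '' hyperplane h

/-- Finite unions of uniform hyperplane sets, with unit normals and positive spacings. -/
def IsUnionOfUniformHyperplaneSets {d : ℕ} (P : Set (Set (E d))) : Prop :=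
  ∃ (N : ℕ) (w h : Fin N → E d) (Δ : Fin N → ℝ), 0 < N ∧ (∀ i, ‖h i‖ = 1) ∧ (∀ i, 0 < Δ i) ∧
    P = ⋃ i, uniformHyperplaneSet (w i) (h i) (Δ i)

/-- The Nyquist manifold sets for `Ω` (of dimension `d - 1`) that are finite unions of uniform
hyperplane sets. -/
def nyquistHyperplaneUnions {d : ℕ} (Ω : Set (E d)) : Set (Set (Set (E d))) :=
  {P | P ∈ nyquistManifoldSets (d - 1) Ω ∧ IsUnionOfUniformHyperplaneSets P}

/-! ### Width -/

/-- The breadth of `Ω` in the direction `u ≠ 0`: the distance between the two supporting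
hyperplanes `⟨·, u⟩ = max_Ω ⟨·, u⟩` and `⟨·, u⟩ = min_Ω ⟨·, u⟩`. -/
def breadth {d : ℕ} (Ω : Set (E d)) (u : E d) : ℝ :=
  (sSup ((fun x => inner ℝ x u) '' Ω) - sInf ((fun x => inner ℝ x u) '' Ω)) / ‖u‖

/-- `u` is a direction in which the breadth of `Ω` is minimal. -/
def IsWidthDirection {d : ℕ} (Ω : Set (E d)) (u : E d) : Prop :=
  u ≠ 0 ∧ ∀ v : E d, v ≠ 0 → breadth Ω u ≤ breadth Ω v

/-- The width of `Ω`: the minimal breadth over all directions. -/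
def width {d : ℕ} (Ω : Set (E d)) : ℝ :=
  sInf (breadth Ω '' {u | u ≠ 0})

/-- The uniform hyperplane set through the origin orthogonal to `u`, with spacing
`2π / width Ω - ε`. -/
def optimalHyperplaneSet {d : ℕ} (Ω : Set (E d)) (u : E d) (ε : ℝ) : Set (Set (E d)) :=
  uniformHyperplaneSet 0 (‖u‖⁻¹ • u) (2 * Real.pi / width Ω - ε)

end

end HyperplaneSampling

open HyperplaneSampling

namespace HyperplaneSampling

open SchwartzMap

/-! Lower bound. Rewrite a finite union of uniform hyperplane sets as finitely many progressions of
parallel planes, any two sharing only finitely many planes. Slicing balls along the normals shows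
that its density is at least the sum of the inverse spacings `1/Δ` (`sum_inv_le_manifoldDensity`).
Suppose this sum is less than `W/2π`, where `W` is the width. Then some nonzero bandlimited field
vanishes on every plane, so no subset of the planes can be a sampling set.

That field is built by a plank-type induction (`exists_fourierInv_eq_zero_on_levelPlanes`).
Multiplying a field by `z * exp(i⟨s • h, r⟩) - 1`, with `s = 2π/Δ` and a suitable phase `z`, kills
it on one progression with unit normal `h`. On the Fourier side this subtracts the spectrum from a
phased copy shifted by `s • h`. To leave room for the shift, use a chord of `C` of length `W`
parallel to `h` (`HasWidthAtLeast.exists_chord`): shrinking `C` by the factor `1 - s/W` towards an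
endpoint of the chord gives a body `C₁` with `C₁` and `C₁ + s • h` both inside `C`, and its width is
still at least `W - s`. The progressions thus use up a total width `∑ 2π/Δ < W`, and a body with
interior remains to carry a bump function.

Upper bound. Planes orthogonal to a width direction with spacing `δ < 2π/W` have density at most
`1/δ` and contain a rectangular lattice with step `δ` along the normal and small steps across it.
The characters indexed by this lattice separate the points of `Ω`, so by Stone–Weierstrass they span
a dense subspace of the continuous functions on `Ω` (`span_charOn_closure_eq_top`). A spectrum
orthogonal to all of them is zero. -/

/-! ### Hyperplanes as level sets of a unit normal -/

/-- The hyperplane `{r | ⟨r, h⟩ = c}`. -/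
def levelPlane {d : ℕ} (h : E d) (c : ℝ) : Set (E d) := {r | inner ℝ r h = c}

theorem image_hyperplane_eq_levelPlane {d : ℕ} (w : E d) {h : E d} (hh : ‖h‖ = 1) (s : ℝ) :
    (fun r : E d => w + s • h + r) '' hyperplane h = levelPlane h (inner ℝ w h + s) := by
  ext r
  simp only [hyperplane, levelPlane, Set.mem_image, Set.mem_ofPred_eq]
  constructor
  · rintro ⟨x, hx, rfl⟩
    simp [inner_add_left, inner_smul_left, hx, hh]
  · intro hr
    refine ⟨r - (w + s • h), ?_, by abel⟩
    simp [inner_add_left, inner_sub_left, inner_smul_left, hr, hh]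

/-- The planes `{r | ⟨r, h⟩ = c + jΔ}`, `j ∈ ℤ`. -/
def levelPlanes {d : ℕ} (h : E d) (c Δ : ℝ) : Set (Set (E d)) :=
  Set.range fun j : ℤ => levelPlane h (c + j * Δ)

theorem uniformHyperplaneSet_eq_levelPlanes {d : ℕ} (w : E d) {h : E d} (hh : ‖h‖ = 1) (Δ : ℝ) :
    uniformHyperplaneSet w h Δ = levelPlanes h (inner ℝ w h) Δ := by
  simp only [uniformHyperplaneSet, levelPlanes, image_hyperplane_eq_levelPlane w hh]

theorem smul_mem_levelPlane {d : ℕ} {h : E d} (hh : ‖h‖ = 1) (c : ℝ) : c • h ∈ levelPlane h c := by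
  simp [levelPlane, inner_smul_left, hh]

theorem levelPlane_injective {d : ℕ} {h : E d} (hh : ‖h‖ = 1) :
    Function.Injective (levelPlane h) := by
  intro a b hab
  have := smul_mem_levelPlane hh a
  rw [hab] at this
  simpa [levelPlane, inner_smul_left, hh] using this

theorem levelPlane_progression_injective {d : ℕ} {h : E d} (hh : ‖h‖ = 1) (c : ℝ) {Δ : ℝ}
    (hΔ : 0 < Δ) : Function.Injective fun j : ℤ => levelPlane h (c + j * Δ) := by
  intro a b hab
  have := levelPlane_injective hh hab
  have h2 : (a : ℝ) * Δ = b * Δ := by linarith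
  exact_mod_cast mul_right_cancel₀ hΔ.ne' h2

/-! ### Sections of balls and the density of one progression -/

/-- The `(d - 1)`-dimensional volume of the section of a ball by a hyperplane. -/
noncomputable def planeSection {d : ℕ} (h x : E d) (a c : ℝ) : ℝ≥0∞ :=
  (μHE[d - 1] : Measure (E d)) (levelPlane h c ∩ Metric.closedBall x a)

/-- Translation along the normal by `c' - c` carries one plane onto the other, preserves Hausdorff
measure, and moves points by `|c' - c|`. -/
theorem section_le_section {d : ℕ} {h : E d} (hh : ‖h‖ = 1) (x : E d) (a c c' : ℝ) :
    planeSection h x a c ≤ planeSection h x (a + |c' - c|) c' := by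
  have hsub : (fun r => (c' - c) • h + r) '' (levelPlane h c ∩ Metric.closedBall x a) ⊆
      levelPlane h c' ∩ Metric.closedBall x (a + |c' - c|) := by
    rintro _ ⟨r, ⟨hr, hra⟩, rfl⟩
    constructor
    · simp only [levelPlane, Set.mem_ofPred_eq] at hr ⊢
      simp [inner_add_left, inner_smul_left, hh, hr]
    · rw [Metric.mem_closedBall, dist_eq_norm] at hra ⊢
      calc ‖(c' - c) • h + r - x‖ = ‖(r - x) + (c' - c) • h‖ := by congr 1; abel
        _ ≤ ‖r - x‖ + ‖(c' - c) • h‖ := norm_add_le _ _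
        _ ≤ a + |c' - c| := by simp [norm_smul, hh, hra]
  unfold planeSection
  rw [← (isometry_add_left ((c' - c) • h)).euclideanHausdorffMeasure_image]
  exact measure_mono hsub

theorem volume_closedBall_eq_lintegral_section {d : ℕ} {h : E d} (hh : ‖h‖ = 1) (x : E d) (a : ℝ) :
    volume (Metric.closedBall x a) = ∫⁻ c : ℝ, planeSection h x a c := by
  have hv : h ≠ 0 := by rintro rfl; simp at hh
  have key := EuclideanGeometry.euclideanHausdorffMeasure_eq_lintegral (0 : E d) hv
    (Metric.isClosed_closedBall (x := x) (ε := a)).measurableSet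
  rw [InnerProductSpace.euclideanHausdorffMeasure_eq_volume] at key
  rw [key]
  have : ‖h‖ₑ = 1 := by rw [← ofReal_norm, hh]; simp
  rw [this, one_mul]
  refine lintegral_congr fun c => ?_
  unfold planeSection
  rw [finrank_euclideanSpace_fin, Set.inter_comm]
  congr 2
  ext r
  simp only [SetLike.mem_coe, AffineSubspace.mem_mk', Submodule.mem_orthogonal_singleton_iff_inner_left,
    levelPlane, Set.mem_ofPred_eq]
  simp [inner_sub_left, inner_smul_left, hh, sub_eq_zero]

theorem lintegral_eq_tsum_Ioc (f : ℝ → ℝ≥0∞) (c : ℝ) {Δ : ℝ} (hΔ : 0 < Δ) :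
    ∫⁻ s, f s = ∑' j : ℤ, ∫⁻ s in Set.Ioc (c + j • Δ) (c + (j + 1) • Δ), f s := by
  rw [← lintegral_iUnion (fun _ => measurableSet_Ioc) (Set.pairwise_disjoint_Ioc_add_zsmul c Δ),
    iUnion_Ioc_add_zsmul hΔ, setLIntegral_univ]

/-- Cut the ball into slabs of thickness `Δ`: every slice of a slab is at most the section of the
enlarged ball by the plane bounding that slab from below. The reverse comparison,
`tsum_section_le_volume_closedBall`, enlarges the slices instead. -/
theorem volume_closedBall_le_tsum_section {d : ℕ} {h : E d} (hh : ‖h‖ = 1) (x : E d) (a c : ℝ)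
    {Δ : ℝ} (hΔ : 0 < Δ) :
    volume (Metric.closedBall x a) ≤
      ENNReal.ofReal Δ * ∑' j : ℤ, planeSection h x (a + Δ) (c + j * Δ) := by
  rw [volume_closedBall_eq_lintegral_section hh, lintegral_eq_tsum_Ioc _ c hΔ,
    ← ENNReal.tsum_mul_left]
  refine ENNReal.tsum_le_tsum fun j => ?_
  calc ∫⁻ s in Set.Ioc (c + j • Δ) (c + (j + 1) • Δ), planeSection h x a s
      ≤ ∫⁻ s in Set.Ioc (c + j • Δ) (c + (j + 1) • Δ), planeSection h x (a + Δ) (c + j * Δ) := by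
        refine setLIntegral_mono measurable_const fun s hs => ?_
        refine (section_le_section hh x a s (c + j * Δ)).trans ?_
        refine measure_mono (Set.inter_subset_inter_right _ (Metric.closedBall_subset_closedBall ?_))
        simp only [zsmul_eq_mul, Set.mem_Ioc] at hs
        push_cast at hs
        have : |c + j * Δ - s| ≤ Δ := by rw [abs_le]; constructor <;> linarith [hs.1, hs.2]
        linarith
    _ = _ := by
        rw [setLIntegral_const, Real.volume_Ioc, mul_comm]
        congr 2
        simp only [zsmul_eq_mul]
        push_cast
        ring

theorem tsum_section_le_volume_closedBall {d : ℕ} {h : E d} (hh : ‖h‖ = 1) (x : E d) (a c : ℝ)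
    {Δ : ℝ} (hΔ : 0 < Δ) :
    ENNReal.ofReal Δ * ∑' j : ℤ, planeSection h x a (c + j * Δ) ≤
      volume (Metric.closedBall x (a + Δ)) := by
  rw [volume_closedBall_eq_lintegral_section hh, lintegral_eq_tsum_Ioc _ c hΔ,
    ← ENNReal.tsum_mul_left]
  refine ENNReal.tsum_le_tsum fun j => ?_
  calc _ = ∫⁻ s in Set.Ioc (c + j • Δ) (c + (j + 1) • Δ), planeSection h x a (c + j * Δ) := by
        rw [setLIntegral_const, Real.volume_Ioc, mul_comm]
        congr 2
        simp only [zsmul_eq_mul]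
        push_cast
        ring
    _ ≤ _ := by
        refine setLIntegral_mono' measurableSet_Ioc fun s hs => ?_
        refine (section_le_section hh x a (c + j * Δ) s).trans ?_
        refine measure_mono (Set.inter_subset_inter_right _ (Metric.closedBall_subset_closedBall ?_))
        simp only [zsmul_eq_mul, Set.mem_Ioc] at hs
        push_cast at hs
        have : |s - (c + j * Δ)| ≤ Δ := by rw [abs_le]; constructor <;> linarith [hs.1, hs.2]
        linarith

theorem volumeInBall_levelPlanes {d : ℕ} {h : E d} (hh : ‖h‖ = 1) (c : ℝ) {Δ : ℝ} (hΔ : 0 < Δ)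
    (a : ℝ) (x : E d) :
    volumeInBall (d - 1) (levelPlanes h c Δ) a x = ∑' j : ℤ, planeSection h x a (c + j * Δ) :=
  tsum_range (fun p : Set (E d) => (μHE[d - 1] : Measure (E d)) (p ∩ Metric.closedBall x a))
    (levelPlane_progression_injective hh c hΔ)

/-- This makes the bounded changes of radius in the slab comparisons invisible to the density. -/
theorem tendsto_volume_closedBall_div {d : ℕ} (b : ℝ) :
    Tendsto (fun a : ℝ => volume (Metric.closedBall (0 : E d) (a + b)) /
      volume (Metric.closedBall (0 : E d) a)) atTop (𝓝 1) := by
  have hlim : Tendsto (fun a : ℝ => ENNReal.ofReal ((1 + b / a) ^ d)) atTop (𝓝 1) := by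
    have : Tendsto (fun a : ℝ => (1 + b / a) ^ d) atTop (𝓝 1) := by
      have h0 : Tendsto (fun a : ℝ => b / a) atTop (𝓝 0) := tendsto_const_nhds.div_atTop tendsto_id
      simpa using (h0.const_add 1).pow d
    simpa using ENNReal.tendsto_ofReal this
  refine hlim.congr' ?_
  filter_upwards [eventually_gt_atTop 0, eventually_gt_atTop (-b)] with a ha hb
  have hB : volume (Metric.ball (0 : E d) 1) ≠ 0 := (Metric.measure_ball_pos _ _ one_pos).ne'
  have hB' : volume (Metric.ball (0 : E d) 1) ≠ ⊤ := measure_ball_lt_top.ne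
  rw [Measure.addHaar_closedBall _ _ ha.le, Measure.addHaar_closedBall _ _ (by linarith),
    ENNReal.mul_div_mul_right _ _ hB hB', finrank_euclideanSpace_fin,
    ← ENNReal.ofReal_div_of_pos (by positivity), ← div_pow]
  congr 2
  field_simp

theorem manifoldDensity_levelPlanes_le {d : ℕ} {h : E d} (hh : ‖h‖ = 1) (c : ℝ)
    {Δ : ℝ} (hΔ : 0 < Δ) :
    manifoldDensity (d - 1) (levelPlanes h c Δ) ≤ ENNReal.ofReal Δ⁻¹ := by
  have hlim := ENNReal.Tendsto.const_mul (a := ENNReal.ofReal Δ⁻¹)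
    (tendsto_volume_closedBall_div (d := d) Δ) (Or.inl one_ne_zero)
  rw [mul_one] at hlim
  rw [← hlim.limsup_eq]
  refine limsup_le_limsup (Eventually.of_forall fun a => ?_)
  simp only
  rw [← mul_div_assoc]
  refine ENNReal.div_le_div_right (iSup_le fun x => ?_) _
  rw [volumeInBall_levelPlanes hh c hΔ, ENNReal.ofReal_inv_of_pos hΔ,
    ← ENNReal.div_eq_inv_mul, ENNReal.le_div_iff_mul_le (by simp [hΔ]) (by simp), mul_comm]
  refine (tsum_section_le_volume_closedBall hh x a c hΔ).trans_eq ?_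
  rw [Measure.addHaar_closedBall_center]

/-! ### Reduction to almost disjoint progressions -/

theorem levelPlane_eq_levelPlane {d : ℕ} {h h' : E d} (hh : ‖h‖ = 1) (hh' : ‖h'‖ = 1) {c c' : ℝ}
    (heq : levelPlane h c = levelPlane h' c') :
    ∃ ε : ℝ, ε * ε = 1 ∧ h' = ε • h ∧ c' = ε * c := by
  set s : ℝ := inner ℝ h' h with hs
  have e1 : inner ℝ h h = (1 : ℝ) := by simp [hh]
  have e1' : inner ℝ h' h' = (1 : ℝ) := by simp [hh']
  have es : inner ℝ h h' = s := by rw [hs, real_inner_comm]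
  have h1 : c • h ∈ levelPlane h' c' := heq ▸ smul_mem_levelPlane hh c
  -- The part of `h'` orthogonal to `h` is tangent to the common plane, hence orthogonal to `h'`
  -- too, which forces `s * s = 1`.
  have h2 : c • h + (h' - s • h) ∈ levelPlane h' c' := by
    rw [← heq]
    simp [levelPlane, inner_add_left, inner_sub_left, inner_smul_left, hh, ← hs]
  simp only [levelPlane, Set.mem_ofPred_eq, inner_add_left, inner_sub_left, real_inner_smul_left,
    es, e1'] at h1 h2
  have hss : s * s = 1 := by linarith
  refine ⟨s, hss, ?_, by linarith⟩
  rw [← sub_eq_zero, ← inner_self_eq_zero (𝕜 := ℝ)]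
  simp only [inner_sub_left, inner_sub_right, real_inner_smul_left, real_inner_smul_right, es, e1',
    e1, ← hs]
  linarith

/-- Two progressions of hyperplanes share at most one hyperplane, or one of them is invariant under
a multiple of the step of the other one. -/
theorem levelPlanes_commensurable {d : ℕ} {h h' : E d} (hh : ‖h‖ = 1) (hh' : ‖h'‖ = 1) (c c' : ℝ)
    (Δ Δ' : ℝ) :
    ∃ n : ℕ, 0 < n ∧ ((levelPlanes h c Δ ∩ levelPlanes h' c' Δ').Subsingleton ∨
      ∀ j k : ℤ, (n : ℤ) ∣ k → levelPlane h (c + j * Δ) ∈ levelPlanes h' c' Δ' →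
        levelPlane h (c + (j + k : ℤ) * Δ) ∈ levelPlanes h' c' Δ') := by
  by_cases hsub : (levelPlanes h c Δ ∩ levelPlanes h' c' Δ').Subsingleton
  · exact ⟨1, one_pos, Or.inl hsub⟩
  rw [Set.not_subsingleton_iff] at hsub
  obtain ⟨_, ⟨⟨j₁, rfl⟩, ⟨m₁, hm₁⟩⟩, _, ⟨⟨j₂, rfl⟩, ⟨m₂, hm₂⟩⟩, hne⟩ := hsub
  have hj : j₂ - j₁ ≠ 0 := by
    intro h0
    apply hne
    rw [sub_eq_zero.mp h0]
  obtain ⟨ε, hε, hε', hc₁⟩ := levelPlane_eq_levelPlane hh hh' hm₁.symm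
  obtain ⟨ε₂, -, hε₂', hc₂⟩ := levelPlane_eq_levelPlane hh hh' hm₂.symm
  have heps : ∀ δ : ℝ, h' = δ • h → δ = ε := by
    intro δ hδ
    have hh0 : h ≠ 0 := by rintro rfl; simp at hh
    rw [hε'] at hδ
    exact (smul_left_injective ℝ hh0 hδ).symm
  obtain rfl := heps _ hε₂'
  -- Two distinct common planes make the spacings commensurable: `j₂ - j₁` steps of the first
  -- progression equal, up to orientation, `m₂ - m₁` steps of the second.
  have hstep : ((m₂ - m₁ : ℤ) : ℝ) * Δ' = ε₂ * ((j₂ - j₁ : ℤ) * Δ) := by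
    push_cast; linarith
  refine ⟨(j₂ - j₁).natAbs, Int.natAbs_pos.mpr hj, Or.inr fun j k hk ⟨m, hm⟩ => ?_⟩
  rw [Int.natAbs_dvd] at hk
  obtain ⟨q, rfl⟩ := hk
  obtain ⟨δ, -, hδ', hc⟩ := levelPlane_eq_levelPlane hh hh' hm.symm
  obtain rfl := heps _ hδ'
  refine ⟨m + (m₂ - m₁) * q, ?_⟩
  have : c' + ((m + (m₂ - m₁) * q : ℤ) : ℝ) * Δ' = δ * (c + (j + (j₂ - j₁) * q : ℤ) * Δ) := by
    push_cast at hstep ⊢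
    linear_combination hc + q * hstep
  simp only [this, hε']
  ext r
  simp only [levelPlane, Set.mem_ofPred_eq, real_inner_smul_right]
  constructor
  · intro hr
    linear_combination δ * hr + (c + (j + (j₂ - j₁) * q : ℤ) * Δ - inner ℝ r h) * hε
  · intro hr; rw [hr]

/-- Split the new progression into residue classes modulo a common multiple `N` of the periods. A
class meets a commensurable member of `S` in all of its planes or in none, and any other member in
at most one plane. Classes already covered by `S` are dropped; the remaining ones meet each member
of `S` in finitely many planes and are disjoint from each other. -/
theorem exists_levelPlanes_family_step {d : ℕ} (S : Finset (E d × ℝ × ℝ))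
    (hS : ∀ t ∈ S, ‖t.1‖ = 1 ∧ 0 < t.2.2)
    (hfin : (S : Set (E d × ℝ × ℝ)).Pairwise fun s t =>
      (levelPlanes s.1 s.2.1 s.2.2 ∩ levelPlanes t.1 t.2.1 t.2.2).Finite)
    {h : E d} (hh : ‖h‖ = 1) (c : ℝ) {Δ : ℝ} (hΔ : 0 < Δ) :
    ∃ T : Finset (E d × ℝ × ℝ), (∀ t ∈ T, ‖t.1‖ = 1 ∧ 0 < t.2.2) ∧
      ((T : Set (E d × ℝ × ℝ)).Pairwise fun s t =>
        (levelPlanes s.1 s.2.1 s.2.2 ∩ levelPlanes t.1 t.2.1 t.2.2).Finite) ∧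
      ⋃ t ∈ T, levelPlanes t.1 t.2.1 t.2.2 =
        (⋃ t ∈ S, levelPlanes t.1 t.2.1 t.2.2) ∪ levelPlanes h c Δ := by
  classical
  have hex : ∀ t : E d × ℝ × ℝ, ∃ n : ℕ, 0 < n ∧ (t ∈ S →
      ((levelPlanes h c Δ ∩ levelPlanes t.1 t.2.1 t.2.2).Subsingleton ∨
      ∀ j k : ℤ, (n : ℤ) ∣ k → levelPlane h (c + j * Δ) ∈ levelPlanes t.1 t.2.1 t.2.2 →
        levelPlane h (c + (j + k : ℤ) * Δ) ∈ levelPlanes t.1 t.2.1 t.2.2)) := by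
    intro t
    by_cases ht : t ∈ S
    · obtain ⟨n, hn, H⟩ := levelPlanes_commensurable hh (hS t ht).1 c t.2.1 Δ t.2.2
      exact ⟨n, hn, fun _ => H⟩
    · exact ⟨1, one_pos, fun h => absurd h ht⟩
  choose n hn hnS using hex
  set N : ℕ := ∏ t ∈ S, n t with hN
  have hNpos : 0 < N := Finset.prod_pos fun t _ => hn t
  have hNR : (0 : ℝ) < N := by exact_mod_cast hNpos
  set f : ℕ → E d × ℝ × ℝ := fun k => (h, c + k * Δ, N * Δ) with hf
  have hlev : ∀ (k : ℕ) (q : ℤ), c + k * Δ + q * (N * Δ) = c + (k + N * q : ℤ) * Δ := by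
    intro k q; push_cast; ring
  set K : Finset ℕ := (Finset.range N).filter fun k =>
    ¬ levelPlanes (f k).1 (f k).2.1 (f k).2.2 ⊆ ⋃ t ∈ S, levelPlanes t.1 t.2.1 t.2.2 with hK
  have hcross : ∀ s ∈ S, ∀ k ∈ K,
      (levelPlanes s.1 s.2.1 s.2.2 ∩ levelPlanes (f k).1 (f k).2.1 (f k).2.2).Finite := by
    intro s hs k hk
    rcases hnS s hs with hsub | hinv
    · refine hsub.finite.subset fun p ⟨hp, ⟨q, hq⟩⟩ => ⟨⟨k + N * q, ?_⟩, hp⟩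
      simp only [hf, hlev] at hq
      exact hq
    · suffices hempty : levelPlanes s.1 s.2.1 s.2.2 ∩
          levelPlanes (f k).1 (f k).2.1 (f k).2.2 = ∅ by simp [hempty]
      by_contra hne
      obtain ⟨_, hp, ⟨q, rfl⟩⟩ := Set.nonempty_iff_ne_empty.mpr hne
      refine (Finset.mem_filter.mp hk).2 fun p' ⟨q', hq'⟩ => ?_
      simp only [hf, hlev] at hp hq'
      refine Set.mem_biUnion hs ?_
      have hdvd : (n s : ℤ) ∣ N * (q' - q) :=
        Dvd.dvd.mul_right (by exact_mod_cast Finset.dvd_prod_of_mem n hs) _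
      have := hinv _ _ hdvd hp
      rwa [show (k : ℤ) + N * q + N * (q' - q) = k + N * q' by ring, hq'] at this
  refine ⟨S ∪ K.image f, ?_, ?_, ?_⟩
  · intro t ht
    rcases Finset.mem_union.mp ht with ht | ht
    · exact hS t ht
    · obtain ⟨k, -, rfl⟩ := Finset.mem_image.mp ht
      exact ⟨hh, by positivity⟩
  · have hsymm : Std.Symm fun s t : E d × ℝ × ℝ =>
        (levelPlanes s.1 s.2.1 s.2.2 ∩ levelPlanes t.1 t.2.1 t.2.2).Finite :=
      ⟨fun s t hst => by rwa [Set.inter_comm]⟩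
    rw [Finset.coe_union, Set.pairwise_union_of_symm]
    refine ⟨hfin, ?_, ?_⟩
    · intro s hs t ht hst
      simp only [Finset.coe_image, Set.mem_image, Finset.mem_coe] at hs ht
      obtain ⟨k, hk, rfl⟩ := hs
      obtain ⟨l, hl, rfl⟩ := ht
      suffices hempty : levelPlanes (f k).1 (f k).2.1 (f k).2.2 ∩
          levelPlanes (f l).1 (f l).2.1 (f l).2.2 = ∅ by simp [hempty]
      by_contra hne
      obtain ⟨_, ⟨q, rfl⟩, ⟨q', hq'⟩⟩ := Set.nonempty_iff_ne_empty.mpr hne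
      simp only [hf, hlev] at hq'
      have heq := levelPlane_progression_injective hh c hΔ hq'
      have hkN := Finset.mem_range.mp (Finset.mem_filter.mp hk).1
      have hlN := Finset.mem_range.mp (Finset.mem_filter.mp hl).1
      have hmod := congrArg (· % (N : ℤ)) heq
      simp only [Int.add_mul_emod_self_left] at hmod
      rw [Int.emod_eq_of_lt (by omega) (by omega), Int.emod_eq_of_lt (by omega) (by omega)] at hmod
      exact hst (by rw [show k = l by omega])
    · intro s hs t ht _
      obtain ⟨k, hk, rfl⟩ := Finset.mem_image.mp (Finset.mem_coe.mp ht)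
      exact hcross s hs k hk
  · apply Set.Subset.antisymm
    · refine Set.iUnion₂_subset fun t ht => ?_
      rcases Finset.mem_union.mp ht with ht | ht
      · exact Set.subset_union_of_subset_left (Set.subset_biUnion_of_mem
          (u := fun t : E d × ℝ × ℝ => levelPlanes t.1 t.2.1 t.2.2) ht) _
      · obtain ⟨k, -, rfl⟩ := Finset.mem_image.mp ht
        rintro p ⟨q, hq⟩
        simp only [hf, hlev] at hq
        exact Or.inr ⟨_, hq⟩
    · refine Set.union_subset (Set.biUnion_subset_biUnion_left fun t ht =>
        Finset.mem_union_left _ ht) ?_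
      rintro _ ⟨j, rfl⟩
      have hN0 : (N : ℤ) ≠ 0 := by exact_mod_cast hNpos.ne'
      obtain ⟨k, hk⟩ := Int.eq_ofNat_of_zero_le (Int.emod_nonneg j hN0)
      have hkN : k < N := by
        have := Int.emod_lt_of_pos j (show (0 : ℤ) < N by exact_mod_cast hNpos)
        omega
      have hmem : levelPlane h (c + j * Δ) ∈ levelPlanes (f k).1 (f k).2.1 (f k).2.2 := by
        refine ⟨j / N, ?_⟩
        simp only [hf, hlev]
        rw [← hk, Int.emod_add_mul_ediv]
      by_cases hsub : levelPlanes (f k).1 (f k).2.1 (f k).2.2 ⊆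
          ⋃ t ∈ S, levelPlanes t.1 t.2.1 t.2.2
      · exact (Set.biUnion_subset_biUnion_left fun t ht => Finset.mem_union_left _ ht) (hsub hmem)
      · refine Set.mem_biUnion (Finset.mem_union_right _ (Finset.mem_image_of_mem f ?_)) hmem
        exact Finset.mem_filter.mpr ⟨Finset.mem_range.mpr hkN, hsub⟩

/-- A finite union of uniform hyperplane sets is a finite union of progressions of hyperplanes any
two of which share only finitely many hyperplanes. -/
theorem exists_levelPlanes_family {d : ℕ} (N : ℕ) (w h : Fin N → E d) (Δ : Fin N → ℝ)
    (hh : ∀ i, ‖h i‖ = 1) (hΔ : ∀ i, 0 < Δ i) :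
    ∃ T : Finset (E d × ℝ × ℝ), (∀ t ∈ T, ‖t.1‖ = 1 ∧ 0 < t.2.2) ∧
      ((T : Set (E d × ℝ × ℝ)).Pairwise fun s t =>
        (levelPlanes s.1 s.2.1 s.2.2 ∩ levelPlanes t.1 t.2.1 t.2.2).Finite) ∧
      ⋃ t ∈ T, levelPlanes t.1 t.2.1 t.2.2 = ⋃ i, uniformHyperplaneSet (w i) (h i) (Δ i) := by
  induction N with
  | zero => exact ⟨∅, by simp, by simp, by simp⟩
  | succ N ih =>
    obtain ⟨S, hS, hfin, hU⟩ := ih (w ∘ Fin.castSucc) (h ∘ Fin.castSucc) (Δ ∘ Fin.castSucc)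
      (fun i => hh _) fun i => hΔ _
    obtain ⟨T, hT, hTfin, hTU⟩ := exists_levelPlanes_family_step S hS hfin (hh (Fin.last N))
      (inner ℝ (w (Fin.last N)) (h (Fin.last N))) (hΔ (Fin.last N))
    refine ⟨T, hT, hTfin, ?_⟩
    rw [hTU, hU, ← uniformHyperplaneSet_eq_levelPlanes _ (hh _)]
    ext p
    simp [Fin.exists_fin_succ']

/-! ### Lower bound for the density of almost disjoint progressions -/

/-- A point outside `F` lies in at most one `A t`, and a point of `F` is counted at most `T.card`
times. -/
theorem sum_tsum_le_tsum_biUnion_add {α ι : Type*} (T : Finset ι) (A : ι → Set α)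
    {F : Set α} (hF : ∀ s ∈ T, ∀ t ∈ T, s ≠ t → A s ∩ A t ⊆ F) (g : α → ℝ≥0∞) :
    ∑ t ∈ T, ∑' p : A t, g p ≤ (∑' p : ↥(⋃ t ∈ T, A t), g p) + T.card * ∑' p : F, g p := by
  classical
  simp only [tsum_subtype]
  rw [← Summable.tsum_finsetSum fun _ _ => ENNReal.summable, ← ENNReal.tsum_mul_left,
    ← ENNReal.tsum_add]
  refine ENNReal.tsum_le_tsum fun p => ?_
  by_cases hp : p ∈ F
  · refine le_add_left ?_
    rw [Set.indicator_of_mem hp, ← nsmul_eq_mul]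
    exact Finset.sum_le_card_nsmul _ _ _ fun t _ => Set.indicator_le_self _ _ _
  · refine le_add_right ?_
    by_cases hex : ∃ s ∈ T, p ∈ A s
    · obtain ⟨s, hs, hps⟩ := hex
      rw [Finset.sum_eq_single_of_mem s hs, Set.indicator_of_mem hps,
        Set.indicator_of_mem (Set.mem_iUnion₂.mpr ⟨s, hs, hps⟩)]
      intro t ht hts
      exact Set.indicator_of_notMem (fun hpt => hp (hF s hs t ht hts.symm ⟨hps, hpt⟩)) _
    · push Not at hex
      rw [Finset.sum_eq_zero fun s hs => Set.indicator_of_notMem (hex s hs) _]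
      exact zero_le

/-- A plane is one member of a progression of any spacing `M`. Since `M` can be taken arbitrarily
large, finitely many planes contribute nothing to the density. -/
theorem planeSection_le {d : ℕ} {h : E d} (hh : ‖h‖ = 1) (x : E d) (a c : ℝ) {M : ℝ} (hM : 0 < M) :
    planeSection h x a c ≤ ENNReal.ofReal M⁻¹ * volume (Metric.closedBall x (a + M)) := by
  rw [ENNReal.ofReal_inv_of_pos hM, ← ENNReal.div_eq_inv_mul,
    ENNReal.le_div_iff_mul_le (by simp [hM]) (by simp), mul_comm]
  refine le_trans ?_ (tsum_section_le_volume_closedBall hh x a c hM)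
  gcongr
  simpa using ENNReal.le_tsum (f := fun j : ℤ => planeSection h x a (c + j * M)) 0

/-- The manifold density of almost disjoint progressions of hyperplanes is at least the sum of the
inverses of the spacings. -/
theorem sum_inv_le_manifoldDensity {d : ℕ} (T : Finset (E d × ℝ × ℝ))
    (hT : ∀ t ∈ T, ‖t.1‖ = 1 ∧ 0 < t.2.2)
    (hfin : (T : Set (E d × ℝ × ℝ)).Pairwise fun s t =>
      (levelPlanes s.1 s.2.1 s.2.2 ∩ levelPlanes t.1 t.2.1 t.2.2).Finite) :
    ∑ t ∈ T, ENNReal.ofReal t.2.2⁻¹ ≤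
      manifoldDensity (d - 1) (⋃ t ∈ T, levelPlanes t.1 t.2.1 t.2.2) := by
  classical
  set A : E d × ℝ × ℝ → Set (Set (E d)) := fun t => levelPlanes t.1 t.2.1 t.2.2 with hA
  set F : Set (Set (E d)) := ⋃ s ∈ T, ⋃ t ∈ T, ⋃ _ : s ≠ t, A s ∩ A t with hF
  have hFfin : F.Finite := by
    refine T.finite_toSet.biUnion fun s hs => T.finite_toSet.biUnion fun t ht => ?_
    exact Set.finite_iUnion fun hst => hfin hs ht hst
  have hFsub : ∀ s ∈ T, ∀ t ∈ T, s ≠ t → A s ∩ A t ⊆ F := by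
    intro s hs t ht hst p hp
    simp only [hF, Set.mem_iUnion]
    exact ⟨s, hs, t, ht, hst, hp⟩
  have hFplane : ∀ p ∈ F, ∃ (h : E d) (c : ℝ), ‖h‖ = 1 ∧ p = levelPlane h c := by
    intro p hp
    simp only [hF, Set.mem_iUnion] at hp
    obtain ⟨s, hs, t, ht, hst, ⟨j, rfl⟩, -⟩ := hp
    exact ⟨_, _, (hT s hs).1, rfl⟩
  set P := ⋃ t ∈ T, A t with hP
  let K : ℝ≥0∞ := T.card * hFfin.toFinset.card
  have hKtop : K ≠ ⊤ := ENNReal.mul_ne_top (by simp) (by simp)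
  let R : ℝ → ℝ → ℝ≥0∞ := fun b a => volume (Metric.closedBall (0 : E d) (a + b)) /
      volume (Metric.closedBall (0 : E d) a)
  let X : ℝ → ℝ≥0∞ := fun a => (⨆ x : E d, volumeInBall (d - 1) P a x) /
      volume (Metric.closedBall (0 : E d) a)
  -- Balls centered at the origin suffice for a lower bound. For each progression the radius is
  -- reduced by its spacing, so that the slab comparison ends at radius `a`; the term with `K` pays
  -- for the shared planes.
  have hmain : ∀ M : ℝ, 0 < M → ∀ a : ℝ,
      ∑ t ∈ T, ENNReal.ofReal t.2.2⁻¹ * R (-t.2.2) a ≤ X a + K * ENNReal.ofReal M⁻¹ * R M a := by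
    intro M hM a
    have h1 : ∑ t ∈ T, ENNReal.ofReal t.2.2⁻¹ * volume (Metric.closedBall (0 : E d) (a + -t.2.2)) ≤
        (⨆ x : E d, volumeInBall (d - 1) P a x) +
          K * ENNReal.ofReal M⁻¹ * volume (Metric.closedBall (0 : E d) (a + M)) := by
      calc _ ≤ ∑ t ∈ T, volumeInBall (d - 1) (A t) a 0 := by
            refine Finset.sum_le_sum fun t ht => ?_
            obtain ⟨hh, hΔ⟩ := hT t ht
            rw [ENNReal.ofReal_inv_of_pos hΔ, ← ENNReal.div_eq_inv_mul]
            refine ENNReal.div_le_of_le_mul' ?_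
            rw [hA, volumeInBall_levelPlanes hh _ hΔ]
            simpa using volume_closedBall_le_tsum_section hh 0 (a + -t.2.2) t.2.1 hΔ
        _ ≤ volumeInBall (d - 1) P a 0 + T.card * ∑' p : F,
              (μHE[d - 1] : Measure (E d)) ((p : Set (E d)) ∩ Metric.closedBall 0 a) :=
            sum_tsum_le_tsum_biUnion_add T A hFsub fun p =>
              (μHE[d - 1] : Measure (E d)) (p ∩ Metric.closedBall 0 a)
        _ ≤ _ := by
            refine add_le_add (le_iSup (fun x => volumeInBall (d - 1) P a x) 0) ?_
            simp only [K, mul_assoc]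
            gcongr
            have := hFfin.fintype
            rw [tsum_fintype, ← nsmul_eq_mul,
              show hFfin.toFinset.card = (Finset.univ : Finset F).card by
                rw [hFfin.card_toFinset]; rfl]
            refine Finset.sum_le_card_nsmul _ _ _ fun p _ => ?_
            obtain ⟨h, c, hh, hp⟩ := hFplane p p.2
            rw [hp]
            exact planeSection_le hh 0 a c hM
    have h2 := ENNReal.div_le_div_right h1 (volume (Metric.closedBall (0 : E d) a))
    rw [ENNReal.add_div, mul_div_assoc] at h2
    refine le_trans (le_of_eq ?_) h2
    simp only [R, div_eq_mul_inv, Finset.sum_mul, mul_assoc]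
  -- First `a → ∞` with `M` fixed, then `M → ∞`; the constant 2 only has to exceed the limit 1 of `R
  -- M`.
  have hlim : ∀ M : ℝ, 0 < M → ∑ t ∈ T, ENNReal.ofReal t.2.2⁻¹ ≤
      manifoldDensity (d - 1) P + K * ENNReal.ofReal M⁻¹ * 2 := by
    intro M hM
    have hl : Tendsto (fun a => ∑ t ∈ T, ENNReal.ofReal t.2.2⁻¹ * R (-t.2.2) a) atTop
        (𝓝 (∑ t ∈ T, ENNReal.ofReal t.2.2⁻¹)) := by
      refine tendsto_finsetSum _ fun t _ => ?_
      simpa using ENNReal.Tendsto.const_mul (a := ENNReal.ofReal t.2.2⁻¹)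
        (tendsto_volume_closedBall_div (d := d) (-t.2.2)) (Or.inl one_ne_zero)
    have hr : ∀ᶠ a in atTop, R M a ≤ 2 :=
      (tendsto_volume_closedBall_div (d := d) M).eventually_le_const ENNReal.one_lt_two
    calc _ = limsup (fun a => ∑ t ∈ T, ENNReal.ofReal t.2.2⁻¹ * R (-t.2.2) a) atTop :=
          hl.limsup_eq.symm
      _ ≤ limsup (fun a => X a + K * ENNReal.ofReal M⁻¹ * 2) atTop :=
          limsup_le_limsup (hr.mono fun a ha => (hmain M hM a).trans
            (add_le_add le_rfl (mul_le_mul_right ha _)))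
      _ = _ := limsup_add_const atTop X _ (by isBoundedDefault) (by isBoundedDefault)
  have hzero : Tendsto (fun M : ℝ => manifoldDensity (d - 1) P + K * ENNReal.ofReal M⁻¹ * 2) atTop
      (𝓝 (manifoldDensity (d - 1) P)) := by
    have h0 : Tendsto (fun M : ℝ => ENNReal.ofReal M⁻¹) atTop (𝓝 0) := by
      simpa using ENNReal.tendsto_ofReal tendsto_inv_atTop_zero
    have := ENNReal.Tendsto.mul_const (b := 2) (ENNReal.Tendsto.const_mul h0 (Or.inr hKtop))
      (Or.inr (by simp))
    simpa using this.const_add (manifoldDensity (d - 1) P)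
  exact ge_of_tendsto hzero ((eventually_gt_atTop 0).mono hlim)

/-! ### Breadth, width and chords -/

theorem isCompact_image_inner {d : ℕ} {Ω : Set (E d)} (hcomp : IsCompact Ω) (u : E d) :
    IsCompact ((fun x => (inner ℝ x u : ℝ)) '' Ω) :=
  hcomp.image (by fun_prop)

theorem inner_sub_le_breadth {d : ℕ} {Ω : Set (E d)} (hcomp : IsCompact Ω) {u : E d} (hu : u ≠ 0)
    {x y : E d} (hx : x ∈ Ω) (hy : y ∈ Ω) : inner ℝ (x - y) u ≤ breadth Ω u * ‖u‖ := by
  rw [breadth, div_mul_cancel₀ _ (norm_ne_zero_iff.mpr hu), inner_sub_left]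
  have hc := isCompact_image_inner hcomp u
  exact sub_le_sub (le_csSup hc.bddAbove ⟨x, hx, rfl⟩) (csInf_le hc.bddBelow ⟨y, hy, rfl⟩)

theorem exists_inner_sub_eq_breadth {d : ℕ} {Ω : Set (E d)} (hne : Ω.Nonempty)
    (hcomp : IsCompact Ω) {u : E d} (hu : u ≠ 0) :
    ∃ x ∈ Ω, ∃ y ∈ Ω, inner ℝ (x - y) u = breadth Ω u * ‖u‖ := by
  rw [breadth, div_mul_cancel₀ _ (norm_ne_zero_iff.mpr hu)]
  have hc := isCompact_image_inner hcomp u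
  obtain ⟨x, hx, hx'⟩ := hc.sSup_mem (hne.image _)
  obtain ⟨y, hy, hy'⟩ := hc.sInf_mem (hne.image _)
  refine ⟨x, hx, y, hy, ?_⟩
  rw [inner_sub_left, ← hx', ← hy']

theorem breadth_smul {d : ℕ} {Ω : Set (E d)} (hne : Ω.Nonempty) (hcomp : IsCompact Ω) {u : E d}
    (hu : u ≠ 0) {c : ℝ} (hc : 0 < c) : breadth Ω (c • u) = breadth Ω u := by
  have hcu : c • u ≠ 0 := smul_ne_zero hc.ne' hu
  have hnu : 0 < ‖u‖ := norm_pos_iff.mpr hu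
  have hn : ‖c • u‖ = c * ‖u‖ := by rw [norm_smul, Real.norm_of_nonneg hc.le]
  obtain ⟨x, hx, y, hy, h1⟩ := exists_inner_sub_eq_breadth hne hcomp hu
  obtain ⟨x', hx', y', hy', h2⟩ := exists_inner_sub_eq_breadth hne hcomp hcu
  have h3 := inner_sub_le_breadth hcomp hcu hx hy
  have h4 := inner_sub_le_breadth hcomp hu hx' hy'
  rw [real_inner_smul_right, hn] at h2 h3
  have hpos : 0 < c * ‖u‖ := by positivity
  apply le_antisymm
  · refine le_of_mul_le_mul_right ?_ hpos
    rw [← h2]; nlinarith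
  · refine le_of_mul_le_mul_right ?_ hpos
    refine le_trans (le_of_eq ?_) h3
    rw [h1]; ring

theorem exists_isWidthDirection {d : ℕ} (hd : 0 < d) {Ω : Set (E d)} (hne : Ω.Nonempty)
    (hcomp : IsCompact Ω) : ∃ u : E d, IsWidthDirection Ω u := by
  have : Nonempty (Fin d) := ⟨⟨0, hd⟩⟩
  have hcont : ContinuousOn (breadth Ω) (Metric.sphere 0 1) := by
    have h1 : Continuous fun u : E d => sSup ((fun x => (inner ℝ x u : ℝ)) '' Ω) :=
      hcomp.continuous_sSup (f := fun (u x : E d) => (inner ℝ x u : ℝ))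
        (by simp only [Function.HasUncurry.uncurry, id]; fun_prop)
    have h2 : Continuous fun u : E d => sInf ((fun x => (inner ℝ x u : ℝ)) '' Ω) :=
      hcomp.continuous_sInf (f := fun (u x : E d) => (inner ℝ x u : ℝ))
        (by simp only [Function.HasUncurry.uncurry, id]; fun_prop)
    refine ((h1.sub h2).continuousOn).div continuous_norm.continuousOn fun u hu => ?_
    rw [mem_sphere_zero_iff_norm.mp hu]; exact one_ne_zero
  obtain ⟨u, hu, hmin⟩ := (isCompact_sphere (0 : E d) 1).exists_isMinOn
    (NormedSpace.sphere_nonempty.mpr zero_le_one) hcont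
  refine ⟨u, ne_zero_of_mem_unit_sphere ⟨u, hu⟩, fun v hv => ?_⟩
  have hv' : 0 < ‖v‖⁻¹ := inv_pos.mpr (norm_pos_iff.mpr hv)
  rw [← breadth_smul hne hcomp hv hv']
  refine hmin ?_
  rw [mem_sphere_zero_iff_norm, norm_smul, norm_inv, norm_norm,
    inv_mul_cancel₀ (norm_ne_zero_iff.mpr hv)]

theorem IsWidthDirection.breadth_eq_width {d : ℕ} {Ω : Set (E d)} {u : E d}
    (hu : IsWidthDirection Ω u) : breadth Ω u = width Ω := by
  have : IsLeast (breadth Ω '' {u | u ≠ 0}) (breadth Ω u) := by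
    refine ⟨⟨u, hu.1, rfl⟩, ?_⟩
    rintro _ ⟨v, hv, rfl⟩
    exact hu.2 v hv
  exact this.csInf_eq.symm

/-- All breadths of `C` are at least `W`. -/
def HasWidthAtLeast {d : ℕ} (C : Set (E d)) (W : ℝ) : Prop :=
  ∀ v : E d, ∃ x ∈ C, ∃ y ∈ C, W * ‖v‖ ≤ inner ℝ (x - y) v

theorem hasWidthAtLeast_width {d : ℕ} (hd : 0 < d) {Ω : Set (E d)} (hne : Ω.Nonempty)
    (hcomp : IsCompact Ω) : HasWidthAtLeast Ω (width Ω) := by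
  intro v
  obtain ⟨u, hu⟩ := exists_isWidthDirection hd hne hcomp
  rcases eq_or_ne v 0 with rfl | hv
  · obtain ⟨x, hx⟩ := hne
    exact ⟨x, hx, x, hx, by simp⟩
  · obtain ⟨x, hx, y, hy, h⟩ := exists_inner_sub_eq_breadth hne hcomp hv
    refine ⟨x, hx, y, hy, ?_⟩
    rw [h, ← hu.breadth_eq_width]
    exact mul_le_mul_of_nonneg_right (hu.2 v hv) (norm_nonneg v)

theorem HasWidthAtLeast.homothety {d : ℕ} {C : Set (E d)} {W : ℝ} (hW : HasWidthAtLeast C W)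
    {l : ℝ} (hl : 0 ≤ l) (b : E d) : HasWidthAtLeast ((fun x => l • x + b) '' C) (l * W) := by
  intro v
  obtain ⟨x, hx, y, hy, h⟩ := hW v
  refine ⟨_, ⟨x, hx, rfl⟩, _, ⟨y, hy, rfl⟩, ?_⟩
  rw [add_sub_add_right_eq_sub, ← smul_sub, real_inner_smul_left, mul_assoc]
  exact mul_le_mul_of_nonneg_left h hl

/-- A compact convex set of width at least `W` has a chord of length `W` in every direction. -/
theorem HasWidthAtLeast.exists_chord {d : ℕ} {C : Set (E d)} {W : ℝ} (hW : HasWidthAtLeast C W)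
    (hW0 : 0 ≤ W) (hcomp : IsCompact C) (hconv : Convex ℝ C) {u : E d} (hu : ‖u‖ = 1) :
    ∃ p ∈ C, p + W • u ∈ C := by
  by_contra! hno
  -- Without such a chord, `C` and `C - W • u` are disjoint, and a separating `v` gives `⟨x - y, v⟩
  -- < -W * ⟨u, v⟩ ≤ W * ‖v‖` for all `x, y ∈ C`, against the width bound.
  have hdisj : Disjoint C ((fun x => -(W • u) + x) '' C) := by
    rw [Set.disjoint_left]
    rintro p hp ⟨q, hq, rfl⟩
    exact hno _ hp (by simpa using hq)
  obtain ⟨f, α, β, hα, hαβ, hβ⟩ := geometric_hahn_banach_compact_closed hconv hcomp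
    (hconv.translate (-(W • u))) ((hcomp.image (by fun_prop)).isClosed) hdisj
  set v := (InnerProductSpace.toDual ℝ (E d)).symm f with hv
  have hfv : ∀ x, f x = inner ℝ x v := by
    intro x
    rw [real_inner_comm, hv, InnerProductSpace.toDual_symm_apply]
  obtain ⟨x, hx, y, hy, h⟩ := hW v
  have h1 := hα x hx
  have h2 := hβ _ ⟨y, hy, rfl⟩
  rw [map_add, map_neg, map_smul, hfv, hfv] at h2
  rw [hfv] at h1
  rw [inner_sub_left] at h
  have h3 : -‖v‖ ≤ inner ℝ u v := by
    have := abs_le.mp (abs_real_inner_le_norm u v)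
    rw [hu, one_mul] at this
    exact this.1
  simp only [smul_eq_mul] at h2
  nlinarith

/-- A convex set without interior lies in a hyperplane and has breadth zero along its normal. -/
theorem HasWidthAtLeast.interior_nonempty {d : ℕ} {C : Set (E d)} {W : ℝ}
    (hW : HasWidthAtLeast C W) (hW0 : 0 < W) (hconv : Convex ℝ C) : (interior C).Nonempty := by
  rw [hconv.interior_nonempty_iff_affineSpan_eq_top]
  obtain ⟨x₀, hx₀, -⟩ := hW 0
  have hne : (affineSpan ℝ C : Set (E d)).Nonempty := ⟨x₀, subset_affineSpan ℝ C hx₀⟩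
  rw [← AffineSubspace.direction_eq_top_iff_of_nonempty hne, ← Submodule.orthogonal_eq_bot_iff,
    Submodule.eq_bot_iff]
  intro v hv
  obtain ⟨x, hx, y, hy, h⟩ := hW v
  have hxy : x - y ∈ (affineSpan ℝ C).direction :=
    AffineSubspace.vsub_mem_direction (subset_affineSpan ℝ C hx) (subset_affineSpan ℝ C hy)
  rw [Submodule.inner_right_of_mem_orthogonal hxy hv] at h
  exact norm_le_zero_iff.mp (nonpos_of_mul_nonpos_right h hW0)

/-! ### Bandlimited fields vanishing on hyperplanes -/

theorem fourierInv_mem_bandlimited {d : ℕ} {Ω : Set (E d)} (φ : 𝓢(E d, ℂ))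
    (hφ : ∀ ξ, φ ξ ≠ 0 → (2 * Real.pi) • ξ ∈ Ω) : ⇑(𝓕⁻ φ : 𝓢(E d, ℂ)) ∈ bandlimited Ω := by
  refine ⟨(𝓕⁻ φ).continuous, (𝓕⁻ φ).memLp 2, ?_⟩
  have h1 : (𝓕 (((𝓕⁻ φ).memLp 2 volume).toLp ⇑(𝓕⁻ φ : 𝓢(E d, ℂ))) :
      Lp ℂ 2 (volume : Measure (E d))) = φ.toLp 2 := by
    change 𝓕 ((𝓕⁻ φ : 𝓢(E d, ℂ)).toLp 2) = φ.toLp 2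
    rw [SchwartzMap.toLp_fourier_eq, FourierTransform.fourier_fourierInv_eq]
  have hpi : (2 * Real.pi) ≠ 0 := by positivity
  have h2 : ∀ᵐ ξ, φ.toLp 2 volume ξ = φ ξ := by
    filter_upwards [φ.coeFn_toLp 2 volume] with ξ hξ using hξ
  filter_upwards [(Measure.quasiMeasurePreserving_smul (volume : Measure (E d))
    (inv_ne_zero hpi)).ae h2] with ω hω hωΩ
  rw [angularFourier, h1, hω]
  by_contra h0
  apply hωΩ
  simpa only [smul_inv_smul₀ hpi] using hφ _ h0

theorem fourierInv_compSubConst_apply {d : ℕ} (φ : 𝓢(E d, ℂ)) (v r : E d) :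
    𝓕⁻ (φ.compSubConstCLM ℂ v) r =
      Complex.exp ((2 * Real.pi * inner ℝ v r : ℝ) * Complex.I) * 𝓕⁻ φ r := by
  rw [fourierInv_coe, fourierInv_coe, Real.fourierInv_eq', Real.fourierInv_eq',
    ← integral_const_mul, ← integral_add_right_eq_self _ v]
  refine integral_congr_ae (Eventually.of_forall fun x => ?_)
  simp only [compSubConstCLM_apply, add_sub_cancel_right, smul_eq_mul, inner_add_left]
  rw [← mul_assoc, ← Complex.exp_add]
  congr 2
  push_cast
  ring

theorem exists_schwartzMap_of_interior_nonempty {d : ℕ} {C : Set (E d)}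
    (hC : (interior C).Nonempty) :
    ∃ φ : 𝓢(E d, ℂ), φ ≠ 0 ∧ ∀ ξ, φ ξ ≠ 0 → (2 * Real.pi) • ξ ∈ C := by
  obtain ⟨x, hx⟩ := hC
  have hpi : (2 * Real.pi) ≠ 0 := by positivity
  have hnhds : (fun ξ : E d => (2 * Real.pi) • ξ) ⁻¹' C ∈ 𝓝 ((2 * Real.pi)⁻¹ • x) := by
    refine (continuous_const_smul (2 * Real.pi)).continuousAt.preimage_mem_nhds ?_
    rw [smul_inv_smul₀ hpi]
    exact mem_interior_iff_mem_nhds.mp hx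
  obtain ⟨f, hsupp, hcs, hf, -, hfx⟩ := exists_contDiff_tsupport_subset (n := ⊤) hnhds
  have hcs' : HasCompactSupport (Complex.ofRealCLM ∘ f) := hcs.comp_left (map_zero _)
  refine ⟨hcs'.toSchwartzMap (Complex.ofRealCLM.contDiff.comp hf), ?_, fun ξ hξ => ?_⟩
  · intro h0
    have : (Complex.ofRealCLM ∘ f) ((2 * Real.pi)⁻¹ • x) = 0 := congrArg (fun g : 𝓢(E d, ℂ) =>
      g ((2 * Real.pi)⁻¹ • x)) h0
    rw [Function.comp_apply, hfx] at this
    simp at this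
  · refine hsupp (subset_tsupport _ ?_)
    intro h0
    apply hξ
    change (Complex.ofRealCLM ∘ f) ξ = 0
    simp [h0]

/-- A function with bounded support is not periodic up to phases. -/
theorem exists_smul_compSubConst_ne {d : ℕ} {φ : 𝓢(E d, ℂ)} (hφ : φ ≠ 0) {C : Set (E d)}
    (hC : Bornology.IsBounded C) (hφC : ∀ ξ, φ ξ ≠ 0 → (2 * Real.pi) • ξ ∈ C) {z : ℂ} (hz : z ≠ 0)
    {v : E d} (hv : v ≠ 0) : z • φ.compSubConstCLM ℂ v - φ ≠ 0 := by
  intro h0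
  obtain ⟨ξ, hξ⟩ : ∃ ξ, φ ξ ≠ 0 := by
    by_contra! h
    exact hφ (SchwartzMap.ext h)
  have hper : ∀ x, φ x = z * φ (x - v) := by
    intro x
    have := congrArg (fun g : 𝓢(E d, ℂ) => g x) h0
    simp only [sub_apply, smul_apply, compSubConstCLM_apply, zero_apply, smul_eq_mul] at this
    exact (sub_eq_zero.mp this).symm
  -- Nonvanishing propagates along `ξ + n • v`, which leaves every bounded set.
  have hall : ∀ n : ℕ, φ (ξ + n • v) ≠ 0 := by
    intro n
    induction n with
    | zero => simpa using hξ
    | succ n ih =>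
      rw [hper, succ_nsmul, ← add_assoc, add_sub_cancel_right]
      exact mul_ne_zero hz ih
  obtain ⟨R, hR⟩ := hC.exists_norm_le
  have hnv : 0 < ‖v‖ := norm_pos_iff.mpr hv
  obtain ⟨n, hn⟩ := exists_nat_gt ((R + ‖ξ‖) / ‖v‖)
  rw [div_lt_iff₀ hnv] at hn
  have h1 := hR _ (hφC _ (hall n))
  have hpi : (1 : ℝ) ≤ 2 * Real.pi := by linarith [Real.pi_gt_three]
  rw [norm_smul, Real.norm_of_nonneg (by linarith)] at h1
  have h2 : ‖n • v‖ ≤ ‖ξ + n • v‖ + ‖ξ‖ := by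
    simpa using norm_sub_le (ξ + n • v) ξ
  have h3 : ‖n • v‖ = n * ‖v‖ := by
    rw [← Nat.cast_smul_eq_nsmul ℝ, norm_smul, Real.norm_natCast]
  rw [h3] at h2
  nlinarith [norm_nonneg (ξ + n • v)]

/-- If the sum of the numbers `2π / Δ` is less than the width of `C`, then there is a nonzero field
bandlimited to `C` that vanishes on all the hyperplanes. -/
theorem exists_fourierInv_eq_zero_on_levelPlanes {d : ℕ} (T : Finset (E d × ℝ × ℝ)) :
    ∀ (C : Set (E d)) (W : ℝ), IsCompact C → Convex ℝ C → HasWidthAtLeast C W →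
      (∀ t ∈ T, ‖t.1‖ = 1 ∧ 0 < t.2.2) → ∑ t ∈ T, 2 * Real.pi / t.2.2 < W →
      ∃ φ : 𝓢(E d, ℂ), φ ≠ 0 ∧ (∀ ξ, φ ξ ≠ 0 → (2 * Real.pi) • ξ ∈ C) ∧
        ∀ t ∈ T, ∀ p ∈ levelPlanes t.1 t.2.1 t.2.2, ∀ r ∈ p, 𝓕⁻ φ r = 0 := by
  classical
  induction T using Finset.induction_on with
  | empty =>
    intro C W _ hconv hW _ hsum
    obtain ⟨φ, h1, h2⟩ := exists_schwartzMap_of_interior_nonempty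
      (hW.interior_nonempty (by simpa using hsum) hconv)
    exact ⟨φ, h1, h2, by simp⟩
  | insert t T ht ih =>
    obtain ⟨h, c, Δ⟩ := t
    intro C W hcomp hconv hW hT hsum
    rw [Finset.sum_insert ht] at hsum
    obtain ⟨hh, hΔ⟩ := hT _ (Finset.mem_insert_self _ _)
    have hT' : ∀ t ∈ T, ‖t.1‖ = 1 ∧ 0 < t.2.2 := fun t ht => hT t (Finset.mem_insert_of_mem ht)
    have hsum0 : 0 ≤ ∑ t ∈ T, 2 * Real.pi / t.2.2 :=
      Finset.sum_nonneg fun t ht => div_nonneg (by positivity) (hT' t ht).2.le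
    simp only at hh hΔ hsum
    set s : ℝ := 2 * Real.pi / Δ with hs
    have hs0 : 0 < s := by positivity
    have hW0 : 0 < W := by linarith
    obtain ⟨p, hp, hpW⟩ := hW.exists_chord hW0.le hcomp hconv hh
    set l : ℝ := 1 - s / W with hl
    have hsW : 0 ≤ s / W := by positivity
    have hl0 : 0 ≤ l := by
      rw [hl, sub_nonneg, div_le_one hW0]; linarith
    have hlW : l * W = W - s := by rw [hl]; field_simp
    -- Contraction of `C` towards the endpoint `p` of the chord. Contracting towards the other
    -- endpoint `p + W • h` with the same ratio gives `C₁ + s • h`, so both lie in `C`.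
    set C₁ := (fun x => l • x + (s / W) • p) '' C with hC₁
    have hsub : C₁ ⊆ C := by
      rintro _ ⟨x, hx, rfl⟩
      exact hconv hx hp hl0 hsW (by rw [hl]; ring)
    have hsub' : ∀ x ∈ C₁, x + s • h ∈ C := by
      rintro _ ⟨x, hx, rfl⟩
      have := hconv hx hpW hl0 hsW (by rw [hl]; ring)
      rwa [smul_add, smul_smul, div_mul_cancel₀ _ hW0.ne', ← add_assoc] at this
    have hconv₁ : Convex ℝ C₁ := by
      have := (hconv.smul l).translate ((s / W) • p)
      rw [← Set.image_smul, Set.image_image] at this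
      rw [hC₁]
      simpa only [add_comm] using this
    obtain ⟨φ, hφ0, hφC, hφT⟩ := ih C₁ (l * W) (hcomp.image (by fun_prop)) hconv₁
      (hW.homothety hl0 _) hT' (by rw [hlW]; linarith)
    set v : E d := Δ⁻¹ • h with hv
    have hv0 : v ≠ 0 := smul_ne_zero (inv_ne_zero hΔ.ne') (by rintro rfl; simp at hh)
    -- The phase is chosen so that the factor in `hval` vanishes when `⟨r, h⟩ = c + jΔ`: the
    -- exponents then add up to `2πij`.
    set z : ℂ := Complex.exp (-((2 * Real.pi * (c / Δ) : ℝ) * Complex.I)) with hz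
    have hval : ∀ r, 𝓕⁻ (z • φ.compSubConstCLM ℂ v - φ) r =
        (z * Complex.exp ((2 * Real.pi * inner ℝ v r : ℝ) * Complex.I) - 1) * 𝓕⁻ φ r := by
      intro r
      rw [sub_eq_add_neg, FourierTransform.fourierInv_add, FourierTransform.fourierInv_smul,
        FourierTransform.fourierInv_neg]
      simp only [add_apply, smul_apply, neg_apply, fourierInv_compSubConst_apply, smul_eq_mul]
      ring
    refine ⟨z • φ.compSubConstCLM ℂ v - φ, exists_smul_compSubConst_ne hφ0 hcomp.isBounded
      (fun ξ hξ => hsub (hφC ξ hξ)) (Complex.exp_ne_zero _) hv0, fun ξ hξ => ?_, ?_⟩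
    · by_cases h1 : φ ξ = 0
      · have h2 : φ (ξ - v) ≠ 0 := by
          intro h2
          simp [h1, h2] at hξ
        have := hsub' _ (hφC _ h2)
        have hvs : (2 * Real.pi) • v = s • h := by rw [hv, smul_smul, hs, div_eq_mul_inv]
        rwa [smul_sub, hvs, sub_add_cancel] at this
      · exact hsub (hφC ξ h1)
    · intro t ht p hp r hr
      rw [hval]
      rcases Finset.mem_insert.mp ht with rfl | ht
      · obtain ⟨j, rfl⟩ := hp
        have hr' : inner ℝ r h = c + j * Δ := hr
        have : inner ℝ v r = c / Δ + j := by
          rw [hv, real_inner_smul_left, real_inner_comm, hr']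
          field_simp
        rw [this, hz, ← Complex.exp_add]
        have hexp : -(((2 * Real.pi * (c / Δ) : ℝ) : ℂ) * Complex.I) +
            ((2 * Real.pi * (c / Δ + j) : ℝ) : ℂ) * Complex.I = j * (2 * Real.pi * Complex.I) := by
          push_cast; ring
        rw [hexp, Complex.exp_int_mul_two_pi_mul_I, sub_self, zero_mul]
      · rw [hφT t ht p hp r hr, mul_zero]

/-! ### Bandlimited fields as inverse Fourier integrals -/

theorem sub_mem_bandlimited {d : ℕ} {Ω : Set (E d)} {f g : E d → ℂ} (hf : f ∈ bandlimited Ω)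
    (hg : g ∈ bandlimited Ω) : f - g ∈ bandlimited Ω := by
  obtain ⟨hfc, hf2, hf⟩ := hf
  obtain ⟨hgc, hg2, hg⟩ := hg
  refine ⟨hfc.sub hgc, hf2.sub hg2, ?_⟩
  have h1 : (𝓕 ((hf2.sub hg2).toLp (f - g)) : Lp ℂ 2 (volume : Measure (E d))) =
      𝓕 (hf2.toLp f) - 𝓕 (hg2.toLp g) := by
    rw [MemLp.toLp_sub, sub_eq_add_neg, FourierTransform.fourier_add,
      FourierTransform.fourier_neg, ← sub_eq_add_neg]
  have hpi : (2 * Real.pi)⁻¹ ≠ 0 := by positivity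
  filter_upwards [hf, hg, (Measure.quasiMeasurePreserving_smul (volume : Measure (E d)) hpi).ae
    (Lp.coeFn_sub (𝓕 (hf2.toLp f) : Lp ℂ 2 (volume : Measure (E d))) (𝓕 (hg2.toLp g)))]
    with ω h2 h3 h4 hω
  rw [angularFourier, h1, h4, Pi.sub_apply]
  have h5 := h2 hω
  have h6 := h3 hω
  rw [angularFourier] at h5 h6
  rw [h5, h6, sub_zero]

theorem zero_mem_bandlimited {d : ℕ} {Ω : Set (E d)} {f : E d → ℂ} (hf : f ∈ bandlimited Ω) :
    (0 : E d → ℂ) ∈ bandlimited Ω := by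
  simpa using sub_mem_bandlimited hf hf

theorem integrable_of_memLp_of_ae_eq_zero_off {d : ℕ} {F : E d → ℂ} (hF : MemLp F 2 volume)
    {K : Set (E d)} (hK : IsCompact K) (hFK : ∀ᵐ ξ, ξ ∉ K → F ξ = 0) : Integrable F := by
  have h1 : IntegrableOn F K := by
    have : IsFiniteMeasure (volume.restrict K : Measure (E d)) :=
      ⟨by simpa using hK.measure_lt_top⟩
    exact (hF.restrict K).integrable one_le_two
  refine (h1.integrable_indicator hK.measurableSet).congr ?_
  filter_upwards [hFK] with ξ hξ
  by_cases h : ξ ∈ K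
  · simp [h]
  · simp [h, hξ h]

theorem continuous_fourierInv_of_integrable {d : ℕ} {F : E d → ℂ} (hF : Integrable F) :
    Continuous (𝓕⁻ F) :=
  VectorFourier.fourierIntegral_continuous Real.continuous_fourierChar
    (by simpa using! continuous_inner.neg) hF

/-- The `L²` inverse Fourier transform of an integrable function is given by the integral. -/
theorem ae_eq_fourierInv_of_integrable {d : ℕ} (g : Lp ℂ 2 (volume : Measure (E d)))
    (hF : Integrable (𝓕 g : Lp ℂ 2 (volume : Measure (E d)))) :
    g =ᵐ[volume] 𝓕⁻ ((𝓕 g : Lp ℂ 2 (volume : Measure (E d))) : E d → ℂ) := by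
  set F : Lp ℂ 2 (volume : Measure (E d)) := 𝓕 g with hFdef
  refine ae_eq_of_integral_contDiff_smul_eq ((Lp.memLp g).locallyIntegrable one_le_two)
    (continuous_fourierInv_of_integrable hF).locallyIntegrable fun ψ hψ hψc => ?_
  have h₁ : HasCompactSupport (Complex.ofRealCLM ∘ ψ) := hψc.comp_left rfl
  have h₂ := Complex.ofRealCLM.contDiff.comp hψ
  set Ψ : 𝓢(E d, ℂ) := h₁.toSchwartzMap h₂ with hΨ
  have hΨv : ∀ x, Ψ x = (ψ x : ℂ) := fun x => rfl
  -- Against a test function, the `L²` inverse transform is that of tempered distributions and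
  -- passes to `Ψ`; Fubini then moves it back onto the integrable `F` as an integral.
  have h3 : ∫ x, Ψ x • g x = ∫ x, 𝓕⁻ Ψ x • F x := by
    have e1 := Lp.fourierInv_toTemperedDistribution_eq F
    rw [hFdef, FourierTransform.fourierInv_fourier_eq] at e1
    have e2 := congrArg (fun S => S Ψ) e1
    simp only [TemperedDistribution.fourierInv_apply, Lp.toTemperedDistribution_apply] at e2
    exact e2.symm
  have h4 : ∫ x, 𝓕⁻ Ψ x • F x = ∫ x, Ψ x • 𝓕⁻ (F : E d → ℂ) x := by
    rw [fourierInv_coe]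
    have := VectorFourier.integral_fourierIntegral_smul_eq_flip (μ := (volume : Measure (E d)))
      (ν := (volume : Measure (E d))) (L := -innerₗ (E d)) Real.continuous_fourierChar
      (by simpa using! continuous_inner.neg) Ψ.integrable hF
    have hflip : (-innerₗ (E d)).flip = -innerₗ (E d) := by
      ext x y; simp [real_inner_comm]
    rw [hflip] at this
    exact this
  simpa only [hΨv, Complex.coe_smul] using! h3.trans h4

/-! ### Uniqueness from values on a subgroup -/

/-- The character `ξ ↦ exp(2πi⟨ξ, r⟩)` on `K`. -/
noncomputable def charOn {d : ℕ} (K : Set (E d)) (r : E d) : C(K, ℂ) where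
  toFun ξ := Complex.exp ((2 * Real.pi * inner ℝ (ξ : E d) r : ℝ) * Complex.I)

theorem charOn_add {d : ℕ} (K : Set (E d)) (r s : E d) :
    charOn K (r + s) = charOn K r * charOn K s := by
  ext ξ
  simp only [charOn, ContinuousMap.coe_mk, ContinuousMap.mul_apply, ← Complex.exp_add,
    inner_add_right]
  congr 1; push_cast; ring

theorem charOn_zero {d : ℕ} (K : Set (E d)) : charOn K 0 = 1 := by
  ext ξ; simp [charOn]

theorem charOn_neg {d : ℕ} (K : Set (E d)) (r : E d) : charOn K (-r) = star (charOn K r) := by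
  ext ξ
  simp [charOn, ← Complex.exp_conj, Complex.conj_ofNat]

/-- The characters of frequencies in an additive subgroup span a dense subspace of the continuous
functions on a compact set on which they separate points. -/
theorem span_charOn_closure_eq_top {d : ℕ} {K : Set (E d)} (hK : IsCompact K)
    (Λ : AddSubgroup (E d))
    (hsep : ∀ x y : K, x ≠ y → ∃ r ∈ Λ, charOn K r x ≠ charOn K r y) :
    (Submodule.span ℂ (charOn K '' Λ)).topologicalClosure = ⊤ := by
  have : CompactSpace K := isCompact_iff_compactSpace.mp hK
  let A : StarSubalgebra ℂ C(K, ℂ) :=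
    { toSubalgebra := Algebra.adjoin ℂ (charOn K '' Λ)
      star_mem' := by
        change Algebra.adjoin ℂ (charOn K '' Λ) ≤ star (Algebra.adjoin ℂ (charOn K '' Λ))
        refine Algebra.adjoin_le ?_
        rintro _ ⟨r, hr, rfl⟩
        exact Algebra.subset_adjoin ⟨-r, Λ.neg_mem hr, charOn_neg K r⟩ }
  -- Characters are closed under products and include 1, so the algebra they generate is their
  -- linear span.
  have hA : A.toSubalgebra.toSubmodule = Submodule.span ℂ (charOn K '' Λ) := by
    apply Algebra.adjoin_eq_span_of_subset
    refine .trans (fun x ↦ Submonoid.closure_induction (fun _ ↦ id)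
      ⟨0, Λ.zero_mem, charOn_zero K⟩ ?_) Submodule.subset_span
    rintro _ _ _ _ ⟨r, hr, rfl⟩ ⟨s, hs, rfl⟩
    exact ⟨r + s, Λ.add_mem hr hs, charOn_add K r s⟩
  have hAsep : A.SeparatesPoints := by
    intro x y hxy
    obtain ⟨r, hr, hne⟩ := hsep x y hxy
    exact ⟨_, ⟨charOn K r, Algebra.subset_adjoin ⟨r, hr, rfl⟩, rfl⟩, hne⟩
  rw [← hA]
  exact congr_arg (Subalgebra.toSubmodule <| StarSubalgebra.toSubalgebra ·)
    (ContinuousMap.starSubalgebra_topologicalClosure_eq_top_of_separatesPoints A hAsep)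

/-- Integration against `F` is a continuous functional on `C(K, ℂ)`. It kills the characters from
`Λ`, hence by density everything, including restrictions of test functions. -/
theorem ae_eq_zero_of_fourierInv_eq_zero {d : ℕ} {K : Set (E d)} (hK : IsCompact K)
    (Λ : AddSubgroup (E d))
    (hsep : ∀ x y : K, x ≠ y → ∃ r ∈ Λ, charOn K r x ≠ charOn K r y) {F : E d → ℂ}
    (hF : Integrable F) (hFK : ∀ᵐ ξ, ξ ∉ K → F ξ = 0) (hΛ : ∀ r ∈ Λ, 𝓕⁻ F r = 0) :
    F =ᵐ[volume] 0 := by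
  have : CompactSpace K := isCompact_iff_compactSpace.mp hK
  have hoff : ∀ g : E d → ℂ, ∫ ξ in K, g ξ * F ξ = ∫ ξ, g ξ * F ξ := by
    intro g
    refine setIntegral_eq_integral_of_ae_compl_eq_zero ?_
    filter_upwards [hFK] with ξ hξ hξK
    rw [hξ hξK, mul_zero]
  let ν : Measure K := Measure.comap Subtype.val volume
  have hFν : Integrable (fun x : K => F x) ν :=
    (integrableOn_iff_comap_subtypeVal hK.measurableSet).mp hF.integrableOn
  have hint : ∀ g : C(K, ℂ), Integrable (fun x : K => g x * F x) ν := fun g =>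
    hFν.bdd_mul (c := ‖g‖) g.continuous.aestronglyMeasurable
      (Eventually.of_forall g.norm_coe_le_norm)
  let ℓ : C(K, ℂ) →L[ℂ] ℂ := LinearMap.mkContinuous
    { toFun := fun g => ∫ x : K, g x * F x ∂ν
      map_add' := fun g h => by
        simp only [ContinuousMap.add_apply, add_mul]
        exact integral_add (hint g) (hint h)
      map_smul' := fun c g => by
        simp only [ContinuousMap.smul_apply, smul_eq_mul, mul_assoc, RingHom.id_apply]
        exact integral_const_mul _ _ } (∫ x : K, ‖F x‖ ∂ν) fun g => by
      refine (norm_integral_le_integral_norm _).trans ?_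
      rw [mul_comm, ← integral_const_mul]
      refine integral_mono (hint g).norm (hFν.norm.const_mul _) fun x => ?_
      simp only [norm_mul]
      exact mul_le_mul_of_nonneg_right (g.norm_coe_le_norm x) (norm_nonneg _)
  have hℓ : ∀ g : C(K, ℂ), ℓ g = ∫ x : K, g x * F x ∂ν := fun g => rfl
  have hker : Submodule.span ℂ (charOn K '' Λ) ≤ ℓ.ker := by
    rw [Submodule.span_le]
    rintro _ ⟨r, hr, rfl⟩
    change ℓ (charOn K r) = 0
    rw [hℓ, ← hΛ r hr, Real.fourierInv_eq']
    simp only [smul_eq_mul]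
    rw [← hoff, ← integral_subtype_comap hK.measurableSet]
    rfl
  have htop : ∀ g : C(K, ℂ), ℓ g = 0 := by
    intro g
    have h1 := Submodule.topologicalClosure_minimal _ hker ℓ.isClosed_ker
    rw [span_charOn_closure_eq_top hK Λ hsep] at h1
    exact h1 (Submodule.mem_top (x := g))
  refine ae_eq_zero_of_integral_contDiff_smul_eq_zero hF.locallyIntegrable fun ψ hψ _ => ?_
  have h2 := htop ⟨fun x : K => (ψ x : ℂ), by have := hψ.continuous; fun_prop⟩
  rw [hℓ] at h2
  simp only [Complex.real_smul]
  rw [← hoff, ← integral_subtype_comap hK.measurableSet]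
  exact h2

/-- A bandlimited field that vanishes on an additive subgroup whose characters separate the points
of the band vanishes identically. -/
theorem eq_zero_of_bandlimited {d : ℕ} {Ω : Set (E d)} (hcomp : IsCompact Ω)
    (Λ : AddSubgroup (E d))
    (hsep : ∀ x ∈ Ω, ∀ y ∈ Ω, (∀ r ∈ Λ, ∃ n : ℤ, inner ℝ (x - y) r = n * (2 * Real.pi)) → x = y)
    {f : E d → ℂ} (hf : f ∈ bandlimited Ω) (hΛ : ∀ r ∈ Λ, f r = 0) : f = 0 := by
  obtain ⟨hfc, hf2, hfΩ⟩ := hf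
  have hpi : (2 * Real.pi) ≠ 0 := by positivity
  set F : Lp ℂ 2 (volume : Measure (E d)) := 𝓕 (hf2.toLp f) with hF
  set K : Set (E d) := (fun x => (2 * Real.pi)⁻¹ • x) '' Ω with hK
  have hKc : IsCompact K := hcomp.image (by fun_prop)
  have hFK : ∀ᵐ ξ, ξ ∉ K → F ξ = 0 := by
    filter_upwards [(Measure.quasiMeasurePreserving_smul (volume : Measure (E d)) hpi).ae hfΩ]
      with ξ hξ hξK
    have h1 : (2 * Real.pi) • ξ ∉ Ω := fun hmem => hξK ⟨_, hmem, inv_smul_smul₀ hpi ξ⟩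
    have h2 := hξ h1
    rwa [angularFourier, inv_smul_smul₀ hpi] at h2
  have hFi : Integrable F := integrable_of_memLp_of_ae_eq_zero_off (Lp.memLp F) hKc hFK
  have hfF : f = 𝓕⁻ (F : E d → ℂ) := by
    rw [← Continuous.ae_eq_iff_eq (volume : Measure (E d)) hfc
      (continuous_fourierInv_of_integrable hFi)]
    exact hf2.coeFn_toLp.symm.trans (ae_eq_fourierInv_of_integrable _ hFi)
  have hF0 : F =ᵐ[volume] (0 : E d → ℂ) := by
    refine ae_eq_zero_of_fourierInv_eq_zero hKc Λ ?_ hFi hFK fun r hr => hfF ▸ hΛ r hr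
    rintro ⟨_, x, hx, rfl⟩ ⟨_, y, hy, rfl⟩ hxy
    by_contra! hall
    refine hxy ?_
    refine Subtype.ext (congrArg (fun x => (2 * Real.pi)⁻¹ • x) (hsep x hx y hy fun r hr => ?_))
    have h1 := hall r hr
    simp only [charOn, ContinuousMap.coe_mk, real_inner_smul_left, mul_inv_cancel_left₀ hpi] at h1
    obtain ⟨n, hn⟩ := Complex.exp_eq_exp_iff_exists_int.mp h1
    refine ⟨n, ?_⟩
    have h2 : ((inner ℝ x r : ℝ) : ℂ) = ((inner ℝ y r + n * (2 * Real.pi) : ℝ) : ℂ) := by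
      refine mul_right_cancel₀ Complex.I_ne_zero ?_
      rw [hn]; push_cast; ring
    rw [inner_sub_left, Complex.ofReal_injective h2]
    ring
  rw [hfF]
  ext r
  rw [Real.fourierInv_eq']
  refine (integral_congr_ae (g := fun _ => 0) ?_).trans (by simp)
  filter_upwards [hF0] with ξ hξ
  simp [hξ]

/-! ### Sampling lattices on equidistant hyperplanes -/

/-- The lattice of the points whose coordinates in `b` are integer multiples of those of `s`. -/
def coordinateLattice {d : ℕ} (b : OrthonormalBasis (Fin d) ℝ (E d)) (s : Fin d → ℝ) :
    AddSubgroup (E d) where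
  carrier := {x | ∀ i, ∃ n : ℤ, inner ℝ x (b i) = n * s i}
  zero_mem' := fun i => ⟨0, by simp⟩
  add_mem' := fun {x y} hx hy i => by
    obtain ⟨m, hm⟩ := hx i
    obtain ⟨n, hn⟩ := hy i
    exact ⟨m + n, by rw [inner_add_left, hm, hn]; push_cast; ring⟩
  neg_mem' := fun {x} hx i => by
    obtain ⟨m, hm⟩ := hx i
    exact ⟨-m, by rw [inner_neg_left, hm]; push_cast; ring⟩

theorem smul_mem_coordinateLattice {d : ℕ} (b : OrthonormalBasis (Fin d) ℝ (E d)) (s : Fin d → ℝ)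
    (i : Fin d) : s i • b i ∈ coordinateLattice b s := by
  intro j
  rcases eq_or_ne i j with rfl | hij
  · exact ⟨1, by simp [real_inner_smul_left]⟩
  · exact ⟨0, by simp [real_inner_smul_left, b.inner_eq_zero hij]⟩

theorem ext_inner_basis {d : ℕ} (b : OrthonormalBasis (Fin d) ℝ (E d)) {x y : E d}
    (h : ∀ i, inner ℝ (x - y) (b i) = (0 : ℝ)) : x = y := by
  rw [← sub_eq_zero]
  rw [← b.sum_repr' (x - y)]
  exact Finset.sum_eq_zero fun i _ => by rw [real_inner_comm, h i, zero_smul]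

theorem uniformlyDiscrete_coordinateLattice {d : ℕ} (b : OrthonormalBasis (Fin d) ℝ (E d))
    {s : Fin d → ℝ} {r : ℝ} (hr : 0 < r) (hs : ∀ i, r < s i) :
    UniformlyDiscrete (coordinateLattice b s : Set (E d)) := by
  refine ⟨r, hr, fun x hx y hy hxy => ?_⟩
  obtain ⟨i, hi⟩ : ∃ i, inner ℝ (x - y) (b i) ≠ (0 : ℝ) := by
    by_contra! h
    exact hxy (ext_inner_basis b h)
  obtain ⟨n, hn⟩ := (coordinateLattice b s).sub_mem hx hy i
  have hn0 : n ≠ 0 := by rintro rfl; simp [hn] at hi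
  have h1 : (1 : ℝ) ≤ |(n : ℝ)| := by exact_mod_cast Int.one_le_abs hn0
  have h2 : |inner ℝ (x - y) (b i)| ≤ ‖x - y‖ := by
    simpa using abs_real_inner_le_norm (x - y) (b i)
  rw [hn, abs_mul, abs_of_pos (hr.trans (hs i))] at h2
  rw [dist_eq_norm]
  nlinarith [hs i]

theorem norm_inv_norm_smul {d : ℕ} {u : E d} (hu : u ≠ 0) : ‖‖u‖⁻¹ • u‖ = 1 := by
  rw [norm_smul, norm_inv, norm_norm, inv_mul_cancel₀ (norm_ne_zero_iff.mpr hu)]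

theorem eq_zero_of_abs_lt_of_int_mul {x c : ℝ} (hc : 0 < c) (h : |x| < c) {n : ℤ}
    (hn : x = n * c) : x = 0 := by
  rw [hn, abs_mul, abs_of_pos hc] at h
  have h1 : |(n : ℝ)| < 1 := by
    by_contra! h1
    nlinarith
  have h2 : n = 0 := Int.abs_lt_one_iff.mp (by exact_mod_cast h1)
  rw [hn, h2]; simp

theorem isManifoldIn_levelPlane {d : ℕ} {h : E d} (hh : ‖h‖ = 1) (c : ℝ) :
    IsManifoldIn (d - 1) (levelPlane h c) := by
  have hh0 : h ≠ 0 := by rintro rfl; simp at hh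
  have hd : 0 < d := by
    rcases Nat.eq_zero_or_pos d with rfl | hd
    · exact absurd (Subsingleton.elim h 0) hh0
    · exact hd
  have hrank : Module.finrank ℝ (ℝ ∙ h)ᗮ = d - 1 := by
    have : Fact (Module.finrank ℝ (E d) = (d - 1) + 1) := ⟨by simp; omega⟩
    exact Submodule.finrank_orthogonal_span_singleton hh0
  have e₁ : (ℝ ∙ h)ᗮ ≃ₜ E (d - 1) :=
    ((stdOrthonormalBasis ℝ (ℝ ∙ h)ᗮ).reindex (finCongr hrank)).repr.toHomeomorph
  have e₂ : levelPlane h c ≃ₜ (ℝ ∙ h)ᗮ :=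
    (Homeomorph.addRight (-(c • h))).subtype fun x => by
      rw [Submodule.mem_orthogonal_singleton_iff_inner_left, Homeomorph.coe_addRight]
      beta_reduce
      rw [← sub_eq_add_neg, inner_sub_left, real_inner_smul_left, real_inner_self_eq_norm_sq, hh,
        one_pow, mul_one, sub_eq_zero]
      rfl
  intro x
  exact ⟨Set.univ, univ_mem, ⟨(Homeomorph.Set.univ _).trans (e₂.trans e₁)⟩⟩

theorem isManifoldSet_uniformHyperplaneSet {d : ℕ} (w : E d) {h : E d} (hh : ‖h‖ = 1) (Δ : ℝ) :
    IsManifoldSet (d - 1) (uniformHyperplaneSet w h Δ) := by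
  rw [uniformHyperplaneSet_eq_levelPlanes w hh]
  refine ⟨Set.countable_range _, ?_⟩
  rintro _ ⟨j, rfl⟩
  exact isManifoldIn_levelPlane hh _

/-- Equidistant hyperplanes orthogonal to `u` contain a sampling set if their spacing is less than
`2π` divided by the breadth in the direction `u`. -/
theorem uniformHyperplaneSet_mem_nyquistHyperplaneUnions {d : ℕ} {Ω : Set (E d)}
    (hcomp : IsCompact Ω) {u : E d} (hu : ‖u‖ = 1) {δ : ℝ} (hδ : 0 < δ)
    (hδΩ : δ * breadth Ω u < 2 * Real.pi) :
    uniformHyperplaneSet 0 u δ ∈ nyquistHyperplaneUnions Ω := by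
  have hu0 : u ≠ 0 := by rintro rfl; simp at hu
  have hd : 0 < d := by
    rcases Nat.eq_zero_or_pos d with rfl | hd
    · exact absurd (Subsingleton.elim u 0) hu0
    · exact hd
  let i₀ : Fin d := ⟨0, hd⟩
  obtain ⟨b, hb⟩ := Orthonormal.exists_orthonormalBasis_extension_of_card_eq (𝕜 := ℝ)
    (E := E d) (ι := Fin d) (by simp) (v := fun _ => u) (s := {i₀})
    ⟨fun _ => hu, fun i j hij => absurd (Subsingleton.elim i j) hij⟩
  have hb₀ : b i₀ = u := hb i₀ rfl
  obtain ⟨D, hD⟩ := hcomp.isBounded.exists_norm_le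
  -- Coordinates of differences of points of `Ω` are at most `2 * |D|` in absolute value, so this
  -- step keeps the phases below `2π`; the `+ 1` makes the inequality strict and the denominator
  -- positive.
  set η : ℝ := Real.pi / (|D| + 1) with hη
  have hD1 : 0 < |D| + 1 := by positivity
  have hη0 : 0 < η := div_pos Real.pi_pos hD1
  let s : Fin d → ℝ := fun i => if i = i₀ then δ else η
  have hs₀ : s i₀ = δ := if_pos rfl
  have hspos : ∀ i, min δ η ≤ s i := by
    intro i
    by_cases hi : i = i₀
    · simp [s, hi]
    · simp [s, hi]
  have hmin : 0 < min δ η := lt_min hδ hη0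
  refine ⟨⟨isManifoldSet_uniformHyperplaneSet 0 hu δ, coordinateLattice b s, ⟨?_, ?_⟩, ?_⟩, ?_⟩
  · exact uniformlyDiscrete_coordinateLattice b (half_pos hmin) fun i =>
      (half_lt_self hmin).trans_le (hspos i)
  · intro f hf g hg hfg
    rw [← sub_eq_zero]
    refine eq_zero_of_bandlimited hcomp (coordinateLattice b s) ?_ (sub_mem_bandlimited hf hg)
      fun r hr => sub_eq_zero.mpr (hfg r hr)
    intro x hx y hy hxy
    refine ext_inner_basis b fun i => ?_
    obtain ⟨n, hn⟩ := hxy _ (smul_mem_coordinateLattice b s i)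
    rw [real_inner_smul_right] at hn
    have hsi : 0 < s i := hmin.trans_le (hspos i)
    -- The phase is an integer multiple of `2π` by `hn`, so being smaller than `2π` forces it to
    -- vanish.
    have hlt : |s i * inner ℝ (x - y) (b i)| < 2 * Real.pi := by
      rw [abs_mul, abs_of_pos hsi]
      by_cases hi : i = i₀
      · rw [hi, hs₀, hb₀]
        have h1 := inner_sub_le_breadth hcomp hu0 hx hy
        have h2 := inner_sub_le_breadth hcomp hu0 hy hx
        rw [hu, mul_one] at h1 h2
        rw [← neg_sub, inner_neg_left] at h2
        exact (mul_le_mul_of_nonneg_left (abs_le'.mpr ⟨h1, h2⟩) hδ.le).trans_lt hδΩ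
      · have h1 : |inner ℝ (x - y) (b i)| ≤ 2 * |D| := by
          calc _ ≤ ‖x - y‖ * ‖b i‖ := abs_real_inner_le_norm _ _
            _ ≤ ‖x‖ + ‖y‖ := by simpa using norm_sub_le x y
            _ ≤ 2 * |D| := by linarith [hD x hx, hD y hy, le_abs_self D]
        have h2 : s i = η := if_neg hi
        have h3 : η * (|D| + 1) = Real.pi := div_mul_cancel₀ _ hD1.ne'
        rw [h2]
        nlinarith
    have h0 := eq_zero_of_abs_lt_of_int_mul (by positivity) hlt hn
    exact (mul_eq_zero.mp h0).resolve_left hsi.ne'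
  · intro x hx
    obtain ⟨n, hn⟩ := hx i₀
    rw [hb₀, hs₀] at hn
    rw [uniformHyperplaneSet_eq_levelPlanes 0 hu]
    exact ⟨_, ⟨n, rfl⟩, by simpa [levelPlane] using hn⟩
  · exact ⟨1, fun _ => 0, fun _ => u, fun _ => δ, one_pos, fun _ => hu, fun _ => hδ,
      (Set.iUnion_const _).symm⟩

/-! ### The value of the infimum -/

/-- The density of a Nyquist union of uniform hyperplane sets is at least the width of the band
divided by `2π`. -/
theorem width_le_manifoldDensity {d : ℕ} (hd : 0 < d) {Ω : Set (E d)} (hne : Ω.Nonempty)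
    (hcomp : IsCompact Ω) (hconv : Convex ℝ Ω) {Q : Set (Set (E d))}
    (hQ : Q ∈ nyquistHyperplaneUnions Ω) :
    ENNReal.ofReal (width Ω / (2 * Real.pi)) ≤ manifoldDensity (d - 1) Q := by
  obtain ⟨⟨-, Λ, ⟨-, hΛ⟩, hΛQ⟩, N, w, h, Δ, -, hh, hΔ, rfl⟩ := hQ
  obtain ⟨T, hT, hfin, hTU⟩ := exists_levelPlanes_family N w h Δ hh hΔ
  rw [← hTU] at hΛQ ⊢
  refine le_trans ?_ (sum_inv_le_manifoldDensity T hT hfin)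
  rw [← ENNReal.ofReal_sum_of_nonneg fun t ht => inv_nonneg.mpr (hT t ht).2.le]
  refine ENNReal.ofReal_le_ofReal ?_
  by_contra! hlt
  rw [lt_div_iff₀ (by positivity), Finset.sum_mul] at hlt
  obtain ⟨φ, hφ0, hφΩ, hφT⟩ := exists_fourierInv_eq_zero_on_levelPlanes T Ω (width Ω) hcomp hconv
    (hasWidthAtLeast_width hd hne hcomp) hT
    (by simpa only [div_eq_inv_mul] using hlt)
  have hmem := fourierInv_mem_bandlimited φ hφΩ
  have hzero := hΛ _ hmem _ (zero_mem_bandlimited hmem) fun x hx => by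
    obtain ⟨p, hp, hxp⟩ := hΛQ hx
    obtain ⟨t, ht, hpt⟩ := Set.mem_iUnion₂.mp hp
    exact hφT t ht p hpt x hxp
  refine hφ0 ?_
  have h0 : (𝓕⁻ φ : SchwartzMap (E d) ℂ) = 0 := SchwartzMap.ext fun x => congrFun hzero x
  have h1 : 𝓕 (𝓕⁻ φ : SchwartzMap (E d) ℂ) = φ := FourierTransform.fourier_fourierInv_eq φ
  rw [← h1, h0, FourierTransform.fourier_zero]

theorem manifoldDensity_uniformHyperplaneSet_le {d : ℕ} (w : E d) {h : E d} (hh : ‖h‖ = 1) {Δ : ℝ}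
    (hΔ : 0 < Δ) : manifoldDensity (d - 1) (uniformHyperplaneSet w h Δ) ≤ ENNReal.ofReal Δ⁻¹ := by
  rw [uniformHyperplaneSet_eq_levelPlanes w hh]
  exact manifoldDensity_levelPlanes_le hh _ hΔ

theorem IsWidthDirection.uniformHyperplaneSet_mem {d : ℕ} {Ω : Set (E d)} (hne : Ω.Nonempty)
    (hcomp : IsCompact Ω) {u : E d} (hu : IsWidthDirection Ω u) {δ : ℝ} (hδ : 0 < δ)
    (hδΩ : δ * width Ω < 2 * Real.pi) :
    uniformHyperplaneSet 0 (‖u‖⁻¹ • u) δ ∈ nyquistHyperplaneUnions Ω := by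
  refine uniformHyperplaneSet_mem_nyquistHyperplaneUnions hcomp (norm_inv_norm_smul hu.1) hδ ?_
  rwa [breadth_smul hne hcomp hu.1 (inv_pos.mpr (norm_pos_iff.mpr hu.1)), hu.breadth_eq_width]

theorem iInf_manifoldDensity_eq {d : ℕ} (hd : 0 < d) {Ω : Set (E d)} (hne : Ω.Nonempty)
    (hcomp : IsCompact Ω) (hconv : Convex ℝ Ω) :
    ⨅ Q ∈ nyquistHyperplaneUnions Ω, manifoldDensity (d - 1) Q =
      ENNReal.ofReal (width Ω / (2 * Real.pi)) := by
  obtain ⟨u, hu⟩ := exists_isWidthDirection hd hne hcomp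
  refine le_antisymm ?_ (le_iInf₂ fun Q hQ => width_le_manifoldDensity hd hne hcomp hconv hQ)
  have hW0 : 0 ≤ width Ω := by
    rw [← hu.breadth_eq_width]
    obtain ⟨x, hx⟩ := hne
    have := inner_sub_le_breadth hcomp hu.1 hx hx
    rw [sub_self, inner_zero_left] at this
    exact nonneg_of_mul_nonneg_left this (norm_pos_iff.mpr hu.1)
  -- Spacing `c⁻¹` with `c` slightly above `W/2π`, instead of a spacing near `2π/W`, also covers
  -- width zero.
  have hbound : ∀ c : ℝ, width Ω / (2 * Real.pi) < c →
      ⨅ Q ∈ nyquistHyperplaneUnions Ω, manifoldDensity (d - 1) Q ≤ ENNReal.ofReal c := by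
    intro c hc
    have hc0 : 0 < c := lt_of_le_of_lt (by positivity) hc
    have hmem := hu.uniformHyperplaneSet_mem hne hcomp (inv_pos.mpr hc0) (by
      rw [div_lt_iff₀ (by positivity)] at hc
      rwa [inv_mul_lt_iff₀ hc0])
    refine (iInf₂_le _ hmem).trans ?_
    simpa using manifoldDensity_uniformHyperplaneSet_le 0 (norm_inv_norm_smul hu.1)
      (inv_pos.mpr hc0)
  have hlim : Tendsto ENNReal.ofReal (𝓝[>] (width Ω / (2 * Real.pi)))
      (𝓝 (ENNReal.ofReal (width Ω / (2 * Real.pi)))) :=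
    (ENNReal.continuous_ofReal.tendsto _).mono_left nhdsWithin_le_nhds
  exact ge_of_tendsto hlim (eventually_nhdsWithin_of_forall hbound)

end HyperplaneSampling

open HyperplaneSampling
theorem theorem6 (d : ℕ) (hd : 0 < d) (Ω : Set (E d)) (hne : Ω.Nonempty) (hcomp : IsCompact Ω)
    (hconv : Convex ℝ Ω) :
    (∃ u : E d, IsWidthDirection Ω u ∧ breadth Ω u = width Ω) ∧
    (⨅ Q ∈ nyquistHyperplaneUnions Ω, manifoldDensity (d - 1) Q)
      = ENNReal.ofReal (width Ω / (2 * Real.pi)) ∧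
    ∀ u : E d, IsWidthDirection Ω u → 0 < width Ω →
      (∀ ε : ℝ, 0 < ε → ε < 2 * Real.pi / width Ω →
        optimalHyperplaneSet Ω u ε ∈ nyquistHyperplaneUnions Ω) ∧
      Tendsto (fun ε : ℝ => manifoldDensity (d - 1) (optimalHyperplaneSet Ω u ε)) (𝓝[>] 0)
        (𝓝 (⨅ Q ∈ nyquistHyperplaneUnions Ω, manifoldDensity (d - 1) Q)) := by
  have hinf := iInf_manifoldDensity_eq hd hne hcomp hconv
  obtain ⟨u₀, hu₀⟩ := exists_isWidthDirection hd hne hcomp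
  refine ⟨⟨u₀, hu₀, hu₀.breadth_eq_width⟩, hinf, fun u hu hW => ?_⟩
  have hmem : ∀ ε : ℝ, 0 < ε → ε < 2 * Real.pi / width Ω →
      optimalHyperplaneSet Ω u ε ∈ nyquistHyperplaneUnions Ω := by
    intro ε hε hεW
    refine hu.uniformHyperplaneSet_mem hne hcomp (sub_pos.mpr hεW) ?_
    rw [sub_mul, div_mul_cancel₀ _ hW.ne']
    linarith [mul_pos hε hW]
  refine ⟨hmem, ?_⟩
  have hev : ∀ᶠ ε in 𝓝[>] (0 : ℝ), 0 < ε ∧ ε < 2 * Real.pi / width Ω :=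
    Ioo_mem_nhdsGT (by positivity)
  have hupper : Tendsto (fun ε : ℝ => ENNReal.ofReal (2 * Real.pi / width Ω - ε)⁻¹) (𝓝[>] 0)
      (𝓝 (⨅ Q ∈ nyquistHyperplaneUnions Ω, manifoldDensity (d - 1) Q)) := by
    rw [hinf]
    refine ENNReal.tendsto_ofReal ?_
    have h1 : Tendsto (fun ε : ℝ => 2 * Real.pi / width Ω - ε) (𝓝[>] 0)
        (𝓝 (2 * Real.pi / width Ω - 0)) :=
      (tendsto_const_nhds.sub tendsto_id).mono_left nhdsWithin_le_nhds
    rw [sub_zero] at h1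
    have h2 := h1.inv₀ (by positivity)
    rwa [inv_div] at h2
  -- Squeeze: membership bounds the density below by the infimum, and the inverse spacing bounds it
  -- above.
  refine tendsto_of_tendsto_of_tendsto_of_le_of_le' tendsto_const_nhds hupper ?_ ?_
  · filter_upwards [hev] with ε hε
    exact iInf₂_le _ (hmem ε hε.1 hε.2)
  · filter_upwards [hev] with ε hε
    exact manifoldDensity_uniformHyperplaneSet_le 0 (norm_inv_norm_smul hu.1) (sub_pos.mpr hε.2)
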